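/- Let $n\ge 0$, let $N$ be a convex $(n+3)$-gon in the plane, and let $R$ be a set of $n$ colors. A triangulation of $N$ is given by its set of diagonals, a maximal set of pairwise non-crossing diagonals of $N$. A colored triangulation of $N$ is a triangulation together with an assignment of a color in $R$ to each of its diagonals such that distinct diagonals have distinct colors. If $d$ is a diagonal of a colored triangulation $t$, flipping $d$ means replacing $d$, which is the common edge of two triangles of $t$, by the other diagonal of the convex quadrilateral formed by these two triangles, and giving this new diagonal the color of $d$. The colorful exchange graph $\mathcal{G}^c_n$ has the colored triangulations of $N$ as its vertices; two of them are adjacent if and only if one is obtained from the other by such a flip, and the edge between them is given the color of the flipped diagonal. For $C\subseteq R$ and a colored triangulation $t$, let $(C,t)$ denote the set of all colored triangulations that can be reached from $t$ by a path in $\mathcal{G}^c_n$ all of whose edges have colors in $C$. Let $\mathcal{A}^c_n$ (the colorful $n$-associahedron) be the set consisting of the empty set and all the sets $(C,t)$, ordered by inclusion. An abstract polytope of rank $n$ is a partially ordered set of faces with a strictly monotone rank function with range $\{-1,0,\dots,n\}$ such that: there are a least face, of rank $-1$, and a greatest face, of rank $n$; every flag (maximal chain) has exactly $n+2$ faces;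 any two flags $\Phi,\Psi$ are joined by a sequence of flags, all containing $\Phi\cap\Psi$, in which consecutive flags differ by exactly one face; and whenever $F<G$ with $\operatorname{rank} G=\operatorname{rank} F+2$, there are exactly two faces $H$ with $F<H<G$. It is simple if for every vertex (face of rank $0$) $F$ the vertex-figure $\{H : F\le H\}$ is isomorphic to the face poset of an $(n-1)$-simplex, that is, to the poset of subsets of an $n$-element set. **Theorem.** The set $(C,t)$ determines $|C|$, and $\mathcal{A}^c_n$, with the rank function $\operatorname{rank}(C,t)=|C|$, $\operatorname{rank}\emptyset=-1$, is a simple abstract polytope of rank $n$ whose $1$-skeleton is $\mathcal{G}^c_n$: the map $t\mapsto\{t\}$ is a bijection from the vertices of $\mathcal{G}^c_n$ to the faces of rank $0$, the map sending an edge joining $t$ and $t'$ to $\{t,t'\}$ is a bijection from the edges of $\mathcal{G}^c_n$ to the faces of rank $1$, and both preserve incidence. -/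

import Mathlib

/-! ### Abstract polytopes -/

/-- Two flags are adjacent if they differ by exactly one face. -/
def Flag.IsAdjacent {P : Type*} [PartialOrder P] (Φ Ψ : Flag P) : Prop :=
  ((Φ : Set P) \ (Ψ : Set P)).ncard = 1 ∧ ((Ψ : Set P) \ (Φ : Set P)).ncard = 1

/-- The partially ordered set `P`, with the rank function `rank`, is an abstract polytope of
rank `n`. Mathlib's `Flag P` is the type of maximal chains of `P`. -/
structure IsAbstractPolytope {P : Type*} [PartialOrder P] (n : ℕ) (rank : P → ℤ) : Prop where
  /-- The rank function is strictly monotone ... -/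
  strictMono : StrictMono rank
  /-- ... with range `{-1, 0, ..., n}`. -/
  range_eq : Set.range rank = Set.Icc (-1 : ℤ) (n : ℤ)
  /-- There is a least face, of rank `-1`. -/
  exists_least : ∃ F : P, rank F = -1 ∧ ∀ G : P, F ≤ G
  /-- There is a greatest face, of rank `n`. -/
  exists_greatest : ∃ F : P, rank F = (n : ℤ) ∧ ∀ G : P, G ≤ F
  /-- Each flag contains exactly `n + 2` faces. -/
  flag_ncard : ∀ Φ : Flag P, (Φ : Set P).ncard = n + 2
  /-- Strong flag-connectedness: any two flags `Φ`, `Ψ` are joined by a sequence of successively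
  adjacent flags, all containing `Φ ∩ Ψ`. -/
  strongly_flag_connected : ∀ Φ Ψ : Flag P,
    Relation.ReflTransGen
      (fun Λ Λ' : Flag P => Λ.IsAdjacent Λ' ∧
        (Φ : Set P) ∩ (Ψ : Set P) ⊆ (Λ : Set P) ∧ (Φ : Set P) ∩ (Ψ : Set P) ⊆ (Λ' : Set P)) Φ Ψ
  /-- The diamond condition. -/
  diamond : ∀ F G : P, F < G → rank G = rank F + 2 →
    {H : P | rank H = rank F + 1 ∧ F < H ∧ H < G}.ncard = 2

/-- A simple abstract polytope of rank `n`: every vertex-figure is isomorphic to the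
`(n-1)`-simplex. The vertex-figure at the vertex `F` is the section between `F` and the greatest
face, i.e. `Set.Ici F`; the face poset of the `(n-1)`-simplex is the poset of all subsets of an
`n`-element set. -/
structure IsSimpleAbstractPolytope {P : Type*} [PartialOrder P] (n : ℕ) (rank : P → ℤ) : Prop
    extends IsAbstractPolytope n rank where
  vertexFigure : ∀ F : P, rank F = 0 → Nonempty (Set.Ici F ≃o Finset (Fin n))

/-- An isomorphism of the graph `G` with the `1`-skeleton of a ranked poset: the vertices of `G`
correspond to the faces of rank `0`, the edges of `G` to the faces of rank `1`, and incidence is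
preserved in both directions. -/
structure OneSkeletonIso {V P : Type*} [PartialOrder P] (G : SimpleGraph V) (rank : P → ℤ) where
  vertexEquiv : V ≃ {F : P // rank F = 0}
  edgeEquiv : G.edgeSet ≃ {F : P // rank F = 1}
  mem_iff_le : ∀ (v : V) (e : G.edgeSet),
    v ∈ (e : Sym2 V) ↔ (vertexEquiv v : P) ≤ (edgeEquiv e : P)

/-! ### Convex polygons and their triangulations -/

/-- Twice the signed area of the triangle `a b c` in the plane. -/
def signedArea2 (a b c : EuclideanSpace ℝ (Fin 2)) : ℝ :=
  (b 0 - a 0) * (c 1 - a 1) - (b 1 - a 1) * (c 0 - a 0)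

/-- `p 0, p 1, ..., p (m-1)` are, in this cyclic order, the vertices of a (strictly) convex
polygon in the plane: all triples of vertices taken in increasing order are nondegenerate and have
the same orientation (counterclockwise or clockwise). -/
def IsConvexPolygon {m : ℕ} (p : Fin m → EuclideanSpace ℝ (Fin 2)) : Prop :=
  (∀ i j k : Fin m, i < j → j < k → 0 < signedArea2 (p i) (p j) (p k)) ∨
  (∀ i j k : Fin m, i < j → j < k → signedArea2 (p i) (p j) (p k) < 0)

/-- The sides of an `(n+3)`-gon join cyclically consecutive vertices
(addition in `Fin (n + 3)` is modulo `n + 3`). -/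
def IsSide {n : ℕ} (e : Sym2 (Fin (n + 3))) : Prop := ∃ i : Fin (n + 3), e = s(i, i + 1)

/-- The diagonals of a convex `(n+3)`-gon join two distinct vertices that are not consecutive. -/
def IsDiagonal {n : ℕ} (e : Sym2 (Fin (n + 3))) : Prop := ¬ e.IsDiag ∧ ¬ IsSide e

/-- The relative interior of the segment joining the two endpoints of `e`. -/
def openChord {m : ℕ} (p : Fin m → EuclideanSpace ℝ (Fin 2)) (e : Sym2 (Fin m)) :
    Set (EuclideanSpace ℝ (Fin 2)) :=
  {x | ∃ i j : Fin m, e = s(i, j) ∧ x ∈ openSegment ℝ (p i) (p j)}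

/-- A set of diagonals is non-crossing if distinct members do not meet in their relative
interiors. -/
def IsNoncrossing {n : ℕ} (p : Fin (n + 3) → EuclideanSpace ℝ (Fin 2))
    (D : Set (Sym2 (Fin (n + 3)))) : Prop :=
  (∀ e ∈ D, IsDiagonal e) ∧ D.PairwiseDisjoint (openChord p)

/-- A triangulation of the convex polygon with vertices `p`, given by its set of diagonals: a
maximal set of pairwise non-crossing diagonals. -/
def IsTriangulation {n : ℕ} (p : Fin (n + 3) → EuclideanSpace ℝ (Fin 2))
    (D : Set (Sym2 (Fin (n + 3)))) : Prop :=
  Maximal (IsNoncrossing p) D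

/-- A colored triangulation, as a set of colored diagonals: the underlying diagonals form a
triangulation, each of them carries one color, and distinct diagonals have distinct colors. -/
@[ext]
structure ColoredTriangulation {n : ℕ} (p : Fin (n + 3) → EuclideanSpace ℝ (Fin 2))
    (R : Type*) where
  diagonals : Set (Sym2 (Fin (n + 3)) × R)
  isTriangulation : IsTriangulation p (Prod.fst '' diagonals)
  color_unique : Set.InjOn Prod.fst diagonals
  color_injective : Set.InjOn Prod.snd diagonals

namespace ColoredTriangulation

variable {n : ℕ} {p : Fin (n + 3) → EuclideanSpace ℝ (Fin 2)} {R : Type*}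

/-- The underlying (uncolored) triangulation. -/
def supp (t : ColoredTriangulation p R) : Set (Sym2 (Fin (n + 3))) := Prod.fst '' t.diagonals

/-- The edges of a triangulation: the sides of the polygon and the diagonals. -/
def IsEdge (t : ColoredTriangulation p R) (e : Sym2 (Fin (n + 3))) : Prop :=
  IsSide e ∨ e ∈ t.supp

/-- `i, j, k` are the vertices of a triangle of the triangulation `t`: any two of them are joined
by an edge of `t` (so they are distinct). -/
def IsTriangle (t : ColoredTriangulation p R) (i j k : Fin (n + 3)) : Prop :=
  t.IsEdge s(i, j) ∧ t.IsEdge s(j, k) ∧ t.IsEdge s(i, k)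

/-- `t'` is obtained from `t` by the color preserving flip of the diagonal of color `c`: this
diagonal `i j` is the common edge of two triangles `i j k` and `i j l` of `t`, and it is replaced
by the other diagonal `k l` of the quadrilateral that they form, with the same color `c`. -/
def IsFlip (c : R) (t t' : ColoredTriangulation p R) : Prop :=
  ∃ i j k l : Fin (n + 3), (s(i, j), c) ∈ t.diagonals ∧
    k ≠ l ∧ t.IsTriangle i j k ∧ t.IsTriangle i j l ∧
    t'.diagonals = insert (s(k, l), c) (t.diagonals \ {(s(i, j), c)})

theorem IsEdge.ne {t : ColoredTriangulation p R} {i j : Fin (n + 3)} (h : t.IsEdge s(i, j)) :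
    i ≠ j := by
  rintro rfl
  rcases h with ⟨k, hk⟩ | h
  · have h1 : k = k + 1 := by
      rcases Sym2.eq_iff.1 hk with ⟨h1, h2⟩ | ⟨h1, h2⟩
      · exact h1.symm.trans h2
      · exact h2.symm.trans h1
    simp at h1
  · exact (t.isTriangulation.prop.1 _ h).1 rfl

theorem IsFlip.symm {c : R} {t t' : ColoredTriangulation p R} (h : IsFlip c t t') :
    IsFlip c t' t := by
  obtain ⟨i, j, k, l, hd, hkl, ⟨hij, hjk, hik⟩, ⟨-, hjl, hil⟩, ht'⟩ := h
  have hne : ∀ a b : Fin (n + 3), s(i, j) ≠ s(a, b) → t.IsEdge s(a, b) → t'.IsEdge s(a, b) := by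
    rintro a b hab (h | ⟨⟨e, c'⟩, h, he⟩)
    · exact Or.inl h
    · refine Or.inr ⟨⟨e, c'⟩, ?_, he⟩
      rw [ht']
      refine Or.inr ⟨h, fun h' => hab ?_⟩
      rw [Set.mem_singleton_iff, Prod.mk.injEq] at h'
      exact h'.1.symm.trans he
  have hk : s(k, l) ≠ s(i, j) := by
    intro h
    rcases Sym2.eq_iff.1 h with ⟨h1, -⟩ | ⟨h1, -⟩
    · exact hik.ne h1.symm
    · exact hjk.ne h1.symm
  have hmem : (s(k, l), c) ∈ t'.diagonals := by rw [ht']; exact Or.inl rfl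
  have hkl' : t'.IsEdge s(k, l) := Or.inr ⟨_, hmem, rfl⟩
  have e1 : t'.IsEdge s(k, i) := by
    rw [Sym2.eq_swap]
    exact hne _ _ (fun h => hjk.ne (by have := hij.ne; simp at h; tauto)) hik
  have e2 : t'.IsEdge s(l, i) := by
    rw [Sym2.eq_swap]
    exact hne _ _ (fun h => hjl.ne (by have := hij.ne; simp at h; tauto)) hil
  have e3 : t'.IsEdge s(k, j) := by
    rw [Sym2.eq_swap]
    refine hne _ _ (fun h => hik.ne ?_) hjk
    have := hij.ne
    rw [Sym2.eq_swap (a := i)] at h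
    simp at h
    tauto
  have e4 : t'.IsEdge s(l, j) := by
    rw [Sym2.eq_swap]
    refine hne _ _ (fun h => hil.ne ?_) hjl
    have := hij.ne
    rw [Sym2.eq_swap (a := i)] at h
    simp at h
    tauto
  refine ⟨k, l, i, j, hmem, hij.ne, ⟨hkl', e2, e1⟩, ⟨hkl', e4, e3⟩, ?_⟩
  ext ⟨e, c'⟩
  rw [ht']
  simp only [Set.mem_insert_iff, Set.mem_sdiff, Set.mem_singleton_iff]
  constructor
  · intro h
    by_cases h1 : (e, c') = (s(i, j), c)
    · exact Or.inl h1
    · refine Or.inr ⟨Or.inr ⟨h, h1⟩, fun h2 => h1 ?_⟩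
      have h3 : c' = c := congrArg Prod.snd h2
      exact t.color_injective h hd h3
  · rintro (h | ⟨h | h, h'⟩)
    · rw [h]; exact hd
    · exact absurd h h'
    · exact h.1

theorem IsFlip.ne {c : R} {t t' : ColoredTriangulation p R} (h : IsFlip c t t') : t ≠ t' := by
  obtain ⟨i, j, k, l, hd, hkl, ⟨hij, hjk, hik⟩, -, ht'⟩ := h
  rintro rfl
  rw [ht'] at hd
  rcases hd with h | h
  · rw [Prod.mk.injEq] at h
    rcases Sym2.eq_iff.1 h.1 with ⟨h1, -⟩ | ⟨-, h1⟩
    · exact hik.ne h1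
    · exact hjk.ne h1
  · exact h.2 rfl

end ColoredTriangulation

/-- The graph on all colored triangulations whose edges are the color preserving flips of
diagonals with colors in `C`. -/
def flipGraph {n : ℕ} (p : Fin (n + 3) → EuclideanSpace ℝ (Fin 2)) {R : Type*} (C : Set R) :
    SimpleGraph (ColoredTriangulation p R) where
  Adj t t' := ∃ c ∈ C, ColoredTriangulation.IsFlip c t t'
  symm := ⟨fun _ _ ⟨c, hc, h⟩ => ⟨c, hc, h.symm⟩⟩
  loopless := ⟨fun _ ⟨_, _, h⟩ => h.ne rfl⟩

/-- The colorful exchange graph: its vertices are the colored triangulations, and two of them are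
adjacent if they differ by a color preserving flip of a diagonal (of any color). -/
def colorfulExchangeGraph {n : ℕ} (p : Fin (n + 3) → EuclideanSpace ℝ (Fin 2)) (R : Type*) :
    SimpleGraph (ColoredTriangulation p R) :=
  flipGraph p (Set.univ : Set R)

/-- The equivalence class of `t` under the relation `∼_C`: all colored triangulations that can be
reached from `t` by a path in the exchange graph all of whose edges have colors in `C`. -/
def colorClass {n : ℕ} {p : Fin (n + 3) → EuclideanSpace ℝ (Fin 2)} {R : Type*}
    (C : Finset R) (t : ColoredTriangulation p R) : Set (ColoredTriangulation p R) :=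
  {t' | (flipGraph p (C : Set R)).Reachable t t'}

/-- The colorful associahedron. Its faces, identified with their vertex sets, are the empty set
and the classes `colorClass C t`, for sets `C` of colors; they are ordered by inclusion. -/
abbrev ColorfulAssociahedron {n : ℕ} (p : Fin (n + 3) → EuclideanSpace ℝ (Fin 2)) (R : Type*) :
    Type _ :=
  {S : Set (ColoredTriangulation p R) //
    S = ∅ ∨ ∃ (C : Finset R) (t : ColoredTriangulation p R), S = colorClass C t}

/-- The face `(C, t)` of the colorful associahedron. -/
def ColorfulAssociahedron.face {n : ℕ} {p : Fin (n + 3) → EuclideanSpace ℝ (Fin 2)} {R : Type*}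
    (C : Finset R) (t : ColoredTriangulation p R) : ColorfulAssociahedron p R :=
  ⟨colorClass C t, Or.inr ⟨C, t, rfl⟩⟩

/-! The proof has two independent halves, joined by the interface `IsColorClassSystem`: for a fixed
color set the classes partition the vertices, inclusion of classes at a common vertex is inclusion
of color sets, one color gives a pair, and all colors give everything.

These properties alone yield the polytope. A nonempty face determines its color set, and the faces
through a vertex `t` form the Boolean lattice of sets of colors; this gives the ranks, the
vertex-figures and the diamonds above nonempty faces. A flag is a vertex together with an
enumeration of the colors, its faces being the classes of the initial segments. To join two flags,
let `C` be the least color set of a common nonempty face. A path from one vertex to the other with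
colors in `C` is followed edge by edge (`exists_adjacentOver_vertex`), and between these moves the
enumerations are adjusted by bubble sort (`reflTransGen_adjacentOver`). Common faces survive both
kinds of moves.

For triangulations, convexity reduces crossing to cyclic order. Each diagonal bounds exactly one
triangle on each side (`exists_apex`, `apex_unique`), so flips exist, are unique and pair up the
vertices for each color. A triangulation has exactly `n` diagonals, hence uses every color. A flip
moves only the diagonal of its own color, so a class whose colors omit `c` fixes the diagonal
colored `c`; therefore inclusion of classes forces inclusion of color sets. Connectedness comes from
flipping to a fan at the vertex `0` and permuting the colors of the fan by five-flip cycles in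
pentagons. -/

/-! ### Polytopes from systems of color classes -/

/-- The sets `cl C t` behave like the classes of vertices reachable from `t` along edges with
colors in `C`, in a connected graph whose edges are properly colored by `R`. -/
structure IsColorClassSystem {V R : Type*} [Fintype R] (cl : Finset R → V → Set V) : Prop where
  mem_self : ∀ C t, t ∈ cl C t
  eq_of_mem : ∀ {C s t}, s ∈ cl C t → cl C s = cl C t
  subset_iff : ∀ {C D t}, cl C t ⊆ cl D t ↔ C ⊆ D
  empty_eq : ∀ t, cl ∅ t = {t}
  univ_eq : ∀ t, cl Finset.univ t = Set.univ
  exists_singleton_eq : ∀ c t, ∃ s, s ≠ t ∧ cl {c} t = {t, s}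
  reflTransGen : ∀ {C s t}, s ∈ cl C t →
    Relation.ReflTransGen (fun a b => ∃ c ∈ C, b ∈ cl {c} a) t s

/-- The poset consisting of the empty set and the classes `cl C t`. -/
abbrev ClassPoset {V R : Type*} (cl : Finset R → V → Set V) : Type _ :=
  {S : Set V // S = ∅ ∨ ∃ (C : Finset R) (t : V), S = cl C t}

namespace ClassPoset

variable {V R : Type*} (cl : Finset R → V → Set V)

/-- The class `cl C t` as a face. -/
def face (C : Finset R) (t : V) : ClassPoset cl := ⟨cl C t, Or.inr ⟨C, t, rfl⟩⟩

/-- The empty face. -/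
def empty : ClassPoset cl := ⟨∅, Or.inl rfl⟩

open Classical in
/-- The rank of `cl C t` is the number of colors in `C`; the empty face has rank `-1`. -/
noncomputable def rank (S : ClassPoset cl) : ℤ :=
  if h : ∃ (C : Finset R) (t : V), S.1 = cl C t then (h.choose.card : ℤ) else -1

variable {cl}

theorem eq_empty_or_face (S : ClassPoset cl) : S = empty cl ∨ ∃ C t, S = face cl C t := by
  obtain ⟨S, rfl | ⟨C, t, rfl⟩⟩ := S
  · exact Or.inl rfl
  · exact Or.inr ⟨C, t, rfl⟩

theorem empty_le (S : ClassPoset cl) : empty cl ≤ S := Set.empty_subset S.1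

end ClassPoset

/-! ### Enumerations of the colors and their initial segments -/

/-- The first `k` elements in the enumeration `σ`. -/
def enumPrefix {n : ℕ} {R : Type*} [Fintype R] (σ : Fin n ≃ R) (k : ℕ) : Finset R :=
  Finset.univ.filter fun c => (σ.symm c : ℕ) < k

section enumPrefix

variable {n : ℕ} {R : Type*} [Fintype R] (σ : Fin n ≃ R)

theorem mem_enumPrefix {k : ℕ} {c : R} : c ∈ enumPrefix σ k ↔ (σ.symm c : ℕ) < k := by
  simp [enumPrefix]

theorem card_enumPrefix {k : ℕ} (hk : k ≤ n) : (enumPrefix σ k).card = k := by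
  have h : (enumPrefix σ k) = (Finset.univ.filter fun i : Fin n => (i : ℕ) < k).map
      σ.toEmbedding := by
    ext c
    simp only [mem_enumPrefix, Finset.mem_map_equiv, Finset.mem_filter, Finset.mem_univ, true_and]
  rw [h, Finset.card_map, Fin.card_filter_val_lt]
  exact min_eq_right hk

theorem enumPrefix_mono {k l : ℕ} (h : k ≤ l) : enumPrefix σ k ⊆ enumPrefix σ l := by
  intro c hc
  rw [mem_enumPrefix] at *
  omega

theorem enumPrefix_zero : enumPrefix σ 0 = ∅ := by
  ext c; simp [mem_enumPrefix]

theorem enumPrefix_self : enumPrefix σ n = Finset.univ := by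
  ext c; simp [mem_enumPrefix]

/-- Every chain of finite sets consists of initial segments of an enumeration. -/
theorem exists_enumPrefix_of_isChain (hn : Fintype.card R = n) (K : Set (Finset R))
    (hK : IsChain (· ≤ ·) K) : ∃ σ : Fin n ≃ R, ∀ C ∈ K, C = enumPrefix σ C.card := by
  classical
  let e : Fin n ≃ R := (Fintype.equivFinOfCardEq hn).symm
  -- `τ x` counts the members of the chain that miss `x`, so elements of a member have smaller
  -- values than elements outside it; sorting by `τ` gives the enumeration.
  let τ : R → ℕ := fun x => {C | C ∈ K ∧ x ∉ C}.ncard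
  have hτ : ∀ C ∈ K, ∀ x ∈ C, ∀ y, y ∉ C → τ x < τ y := by
    intro C hC x hx y hy
    refine Set.ncard_lt_ncard ?_ (Set.toFinite _)
    refine ⟨fun D hD => ⟨hD.1, fun hyD => ?_⟩, fun h => (h ⟨hC, hy⟩).2 hx⟩
    rcases hK.total hC hD.1 with h | h
    · exact hD.2 (h hx)
    · exact hy (h hyD)
  let σ : Fin n ≃ R := (Tuple.sort (τ ∘ e)).trans e
  have hσ : Monotone (τ ∘ σ) := Tuple.monotone_sort (τ ∘ e)
  refine ⟨σ, fun C hC => ?_⟩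
  have hle : C.card ≤ n := hn ▸ Finset.card_le_univ C
  refine Finset.eq_of_subset_of_card_le (fun x hx => ?_) (card_enumPrefix σ hle).le
  rw [mem_enumPrefix]
  have hsub : (Finset.Iic (σ.symm x)).map σ.toEmbedding ⊆ C := by
    intro y hy
    rw [Finset.mem_map_equiv, Finset.mem_Iic] at hy
    by_contra hyC
    have h1 := hτ C hC x hx y hyC
    have h2 := hσ hy
    simp only [Function.comp_apply, Equiv.apply_symm_apply] at h2
    omega
  have := Finset.card_le_card hsub
  rw [Finset.card_map, Fin.card_Iic] at this
  omega

end enumPrefix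

/-! ### Ranks, flags and flag-connectedness of the poset of classes -/

namespace IsColorClassSystem

open ClassPoset

variable {V R : Type*} [Fintype R] {cl : Finset R → V → Set V}

theorem eq_and_mem_iff (h : IsColorClassSystem cl) {C D : Finset R} {s t : V} :
    cl C t ⊆ cl D s ↔ C ⊆ D ∧ t ∈ cl D s := by
  constructor
  · intro hs
    have ht := hs (h.mem_self C t)
    rw [← h.eq_of_mem ht] at hs
    exact ⟨h.subset_iff.1 hs, ht⟩
  · rintro ⟨hs, ht⟩
    rw [← h.eq_of_mem ht]
    exact h.subset_iff.2 hs

theorem color_eq (h : IsColorClassSystem cl) {C D : Finset R} {s t : V} (he : cl C t = cl D s) :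
    C = D :=
  (h.eq_and_mem_iff.1 he.subset).1.antisymm (h.eq_and_mem_iff.1 he.symm.subset).1

/-- Equal classes have equal color sets by `color_eq`, so the choice made in `rank` is immaterial.
-/
theorem rank_face (h : IsColorClassSystem cl) (C : Finset R) (t : V) :
    rank cl (face cl C t) = C.card := by
  have hex : ∃ (D : Finset R) (s : V), (face cl C t).1 = cl D s := ⟨C, t, rfl⟩
  rw [rank, dif_pos hex]
  obtain ⟨s, hs⟩ := hex.choose_spec
  rw [← h.color_eq hs]

theorem rank_empty (h : IsColorClassSystem cl) : rank cl (empty cl) = -1 := by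
  rw [rank, dif_neg]
  rintro ⟨C, t, ht⟩
  have := h.mem_self C t
  rw [← ht] at this
  exact this

theorem face_le_face_iff (h : IsColorClassSystem cl) {C D : Finset R} {s t : V} :
    face cl C t ≤ face cl D s ↔ C ⊆ D ∧ t ∈ cl D s := h.eq_and_mem_iff

theorem face_le_face_iff' (h : IsColorClassSystem cl) {C D : Finset R} {t : V} :
    face cl C t ≤ face cl D t ↔ C ⊆ D := h.subset_iff

theorem face_eq_of_mem (h : IsColorClassSystem cl) {C : Finset R} {s t : V} (hs : s ∈ cl C t) :
    face cl C s = face cl C t := Subtype.ext (h.eq_of_mem hs)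

theorem eq_face_of_mem (h : IsColorClassSystem cl) {S : ClassPoset cl} {t : V} (ht : t ∈ S.1) :
    ∃ C, S = face cl C t := by
  rcases eq_empty_or_face S with rfl | ⟨C, s, rfl⟩
  · exact ht.elim
  · exact ⟨C, (h.face_eq_of_mem ht).symm⟩

theorem face_ne_empty (h : IsColorClassSystem cl) (C : Finset R) (t : V) :
    face cl C t ≠ empty cl := by
  intro he
  have h1 := h.rank_face C t
  rw [he, h.rank_empty] at h1
  omega

theorem rank_strictMono (h : IsColorClassSystem cl) : StrictMono (rank cl) := by
  intro S T hST
  rcases eq_empty_or_face T with rfl | ⟨D, t, rfl⟩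
  · exact absurd (empty_le S) hST.not_ge
  rcases eq_empty_or_face S with rfl | ⟨C, s, rfl⟩
  · rw [h.rank_empty, h.rank_face]
    omega
  · rw [h.rank_face, h.rank_face]
    obtain ⟨h1, h2⟩ := h.face_le_face_iff.1 hST.le
    have h3 : C ≠ D := by
      rintro rfl
      exact hST.ne (h.face_eq_of_mem h2)
    exact_mod_cast Finset.card_lt_card (lt_of_le_of_ne h1 h3)

/-- The chain consisting of the empty face and the classes of `t` for the initial segments of an
enumeration of the colors. -/
def flagSet {n : ℕ} (cl : Finset R → V → Set V) (t : V) (σ : Fin n ≃ R) : Set (ClassPoset cl) :=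
  {S | S = empty cl ∨ ∃ k ≤ n, S = face cl (enumPrefix σ k) t}

variable {n : ℕ}

theorem isChain_flagSet (h : IsColorClassSystem cl) (t : V) (σ : Fin n ≃ R) :
    IsChain (· ≤ ·) (flagSet cl t σ) := by
  rintro S (rfl | ⟨k, -, rfl⟩) T (rfl | ⟨l, -, rfl⟩) -
  · exact Or.inl (empty_le _)
  · exact Or.inl (empty_le _)
  · exact Or.inr (empty_le _)
  · rcases le_total k l with hkl | hkl
    · exact Or.inl (h.face_le_face_iff'.2 (enumPrefix_mono σ hkl))
    · exact Or.inr (h.face_le_face_iff'.2 (enumPrefix_mono σ hkl))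

theorem rank_image_flagSet (h : IsColorClassSystem cl) (t : V) (σ : Fin n ≃ R) :
    rank cl '' flagSet cl t σ = Set.Icc (-1 : ℤ) n := by
  ext z
  simp only [Set.mem_image, Set.mem_Icc]
  constructor
  · rintro ⟨S, rfl | ⟨k, hk, rfl⟩, rfl⟩
    · rw [h.rank_empty]; omega
    · rw [h.rank_face, card_enumPrefix σ hk]; omega
  · rintro ⟨h1, h2⟩
    rcases eq_or_lt_of_le h1 with rfl | h3
    · exact ⟨_, Or.inl rfl, h.rank_empty⟩
    · refine ⟨_, Or.inr ⟨z.toNat, by omega, rfl⟩, ?_⟩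
      rw [h.rank_face, card_enumPrefix σ (by omega)]
      omega

theorem rank_mem_Icc (h : IsColorClassSystem cl) (hn : Fintype.card R = n) (S : ClassPoset cl) :
    rank cl S ∈ Set.Icc (-1 : ℤ) n := by
  rcases eq_empty_or_face S with rfl | ⟨C, t, rfl⟩
  · rw [h.rank_empty, Set.mem_Icc]; omega
  · rw [h.rank_face, Set.mem_Icc]
    have := hn ▸ Finset.card_le_univ C
    omega

theorem rank_injOn_of_isChain (h : IsColorClassSystem cl) {K : Set (ClassPoset cl)}
    (hK : IsChain (· ≤ ·) K) : Set.InjOn (rank cl) K := by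
  intro S hS T hT he
  by_contra hne
  rcases hK.total hS hT with hle | hle
  · exact (h.rank_strictMono (lt_of_le_of_ne hle hne)).ne he
  · exact (h.rank_strictMono (lt_of_le_of_ne hle (Ne.symm hne))).ne he.symm

/-- The flag with the given vertex and the given order of the colors. -/
def flag (h : IsColorClassSystem cl) (hn : Fintype.card R = n) (t : V) (σ : Fin n ≃ R) :
    Flag (ClassPoset cl) where
  carrier := flagSet cl t σ
  Chain' := h.isChain_flagSet t σ
  max_chain' := by
    intro K hK hsub
    refine hsub.antisymm fun S hS => ?_
    -- The ranks of `flagSet` already fill the whole range, and the rank is injective on chains, so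
    -- a longer chain has no room for `S`.
    have hr := h.rank_mem_Icc hn S
    rw [← h.rank_image_flagSet t σ] at hr
    obtain ⟨T, hT, he⟩ := hr
    rwa [← h.rank_injOn_of_isChain hK (hsub hT) hS he]

theorem mem_flag (h : IsColorClassSystem cl) (hn : Fintype.card R = n) {t : V} {σ : Fin n ≃ R}
    {S : ClassPoset cl} :
    S ∈ (h.flag hn t σ : Set (ClassPoset cl)) ↔
      S = empty cl ∨ ∃ k ≤ n, S = face cl (enumPrefix σ k) t := Iff.rfl

theorem face_mem_flag_iff (h : IsColorClassSystem cl) (hn : Fintype.card R = n) {t : V}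
    {σ : Fin n ≃ R} {C : Finset R} {s : V} :
    face cl C s ∈ (h.flag hn t σ : Set (ClassPoset cl)) ↔
      C = enumPrefix σ C.card ∧ t ∈ cl C s := by
  rw [mem_flag]
  constructor
  · rintro (h1 | ⟨k, hk, h1⟩)
    · exact absurd h1 (h.face_ne_empty _ _)
    · have h2 := h.color_eq (congrArg Subtype.val h1)
      refine ⟨?_, ?_⟩
      · rw [h2, card_enumPrefix σ hk]
      · have : t ∈ (face cl C s).1 := by rw [h1]; exact h.mem_self _ t
        exact this
  · rintro ⟨h1, h2⟩
    refine Or.inr ⟨C.card, hn ▸ Finset.card_le_univ C, ?_⟩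
    rw [← h1, h.face_eq_of_mem h2]

/-- Faces through a common vertex are ordered as their color sets, and a chain of color sets
consists of initial segments of an enumeration. -/
theorem exists_subset_flag (h : IsColorClassSystem cl) (hn : Fintype.card R = n)
    {K : Set (ClassPoset cl)} (hK : IsChain (· ≤ ·) K) (t : V)
    (ht : ∀ S ∈ K, S ≠ empty cl → t ∈ S.1) : ∃ σ : Fin n ≃ R, K ⊆ h.flag hn t σ := by
  have hch : IsChain (· ≤ ·) {C : Finset R | face cl C t ∈ K} := by
    intro C hC D hD hne
    rcases hK.total hC hD with hle | hle
    · exact Or.inl (h.face_le_face_iff'.1 hle)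
    · exact Or.inr (h.face_le_face_iff'.1 hle)
  obtain ⟨σ, hσ⟩ := exists_enumPrefix_of_isChain hn _ hch
  refine ⟨σ, fun S hS => ?_⟩
  by_cases he : S = empty cl
  · exact Or.inl he
  · obtain ⟨C, rfl⟩ := h.eq_face_of_mem (ht S hS he)
    exact (h.face_mem_flag_iff hn).2 ⟨hσ C hS, h.mem_self C t⟩

/-- A nonempty face of smallest rank in the chain lies in all the others, so any vertex of it will
do. -/
theorem exists_mem_of_isChain (h : IsColorClassSystem cl) [Nonempty V] {K : Set (ClassPoset cl)}
    (hK : IsChain (· ≤ ·) K) : ∃ t, ∀ S ∈ K, S ≠ empty cl → t ∈ S.1 := by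
  by_cases hne : ∃ m : ℕ, ∃ C t, face cl C t ∈ K ∧ C.card = m
  · classical
    obtain ⟨C, t, hC, hm⟩ := Nat.find_spec hne
    refine ⟨t, fun S hS he => ?_⟩
    obtain ⟨D, s, rfl⟩ := (eq_empty_or_face S).resolve_left he
    rcases hK.total hC hS with hle | hle
    · exact hle (h.mem_self C t)
    · have h1 : Nat.find hne ≤ D.card := Nat.find_min' hne ⟨D, s, hS, rfl⟩
      obtain ⟨h2, h3⟩ := h.face_le_face_iff.1 hle
      have h4 : D = C := Finset.eq_of_subset_of_card_le h2 (by omega)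
      subst h4
      change t ∈ cl D s
      rw [h.eq_of_mem h3]
      exact h.mem_self D t
  · refine ⟨Classical.arbitrary V, fun S hS he => ?_⟩
    obtain ⟨D, s, rfl⟩ := (eq_empty_or_face S).resolve_left he
    exact absurd ⟨_, D, s, hS, rfl⟩ hne

theorem exists_eq_flag (h : IsColorClassSystem cl) [Nonempty V] (hn : Fintype.card R = n)
    (Φ : Flag (ClassPoset cl)) : ∃ t σ, Φ = h.flag hn t σ := by
  obtain ⟨t, ht⟩ := h.exists_mem_of_isChain Φ.Chain'
  obtain ⟨σ, hσ⟩ := h.exists_subset_flag hn Φ.Chain' t ht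
  exact ⟨t, σ, Flag.ext (Φ.max_chain' (h.flag hn t σ).Chain' hσ)⟩

theorem flag_ncard (h : IsColorClassSystem cl) (hn : Fintype.card R = n) (t : V) (σ : Fin n ≃ R) :
    (h.flag hn t σ : Set (ClassPoset cl)).ncard = n + 2 := by
  change (flagSet cl t σ).ncard = n + 2
  rw [← (h.rank_injOn_of_isChain (h.isChain_flagSet t σ)).ncard_image, h.rank_image_flagSet, ← Finset.coe_Icc, Set.ncard_coe_finset, Int.card_Icc]
  omega

/-- Both flags have `n + 2` faces, so losing exactly one face means gaining exactly one. -/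
theorem flag_isAdjacent (h : IsColorClassSystem cl) (hn : Fintype.card R = n) {s t : V}
    {σ τ : Fin n ≃ R} {X : ClassPoset cl} (hX : X ∈ (h.flag hn t σ : Set (ClassPoset cl)))
    (hX' : X ∉ (h.flag hn s τ : Set (ClassPoset cl)))
    (hsub : ∀ Y ∈ (h.flag hn t σ : Set (ClassPoset cl)), Y ≠ X →
      Y ∈ (h.flag hn s τ : Set (ClassPoset cl))) :
    (h.flag hn t σ).IsAdjacent (h.flag hn s τ) := by
  have h1 : ((h.flag hn t σ : Set (ClassPoset cl)) \ (h.flag hn s τ : Set (ClassPoset cl))).ncard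
      = 1 := by
    rw [Set.ncard_eq_one]
    refine ⟨X, Set.ext fun Y => ⟨fun hY => ?_, fun hY => ?_⟩⟩
    · by_contra hne
      exact hY.2 (hsub Y hY.1 hne)
    · rw [hY]
      exact ⟨hX, hX'⟩
  refine ⟨h1, ?_⟩
  rw [← h1, eq_comm]
  refine (Set.ncard_eq_ncard_iff_ncard_sdiff_eq_ncard_sdiff (Set.finite_of_ncard_ne_zero ?_)
    (Set.finite_of_ncard_ne_zero ?_)).1 ?_ <;> simp [flag_ncard]

/-- Adjacency of flags both containing `K`. -/
def AdjacentOver {P : Type*} [PartialOrder P] (K : Set P) (Φ Ψ : Flag P) : Prop :=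
  Φ.IsAdjacent Ψ ∧ K ⊆ Φ ∧ K ⊆ Ψ

/-- Exchanging two consecutive colors which are out of order with respect to `τ`. -/
theorem adjacentOver_swap (h : IsColorClassSystem cl) (hn : Fintype.card R = n) (t : V)
    {σ τ : Fin n ≃ R} {a b : Fin n} (hab : (b : ℕ) = a + 1)
    (hlt : τ.symm (σ b) < τ.symm (σ a)) {K : Set (ClassPoset cl)} (hσ : K ⊆ h.flag hn t σ)
    (hτ : K ⊆ h.flag hn t τ) :
    AdjacentOver K (h.flag hn t σ) (h.flag hn t ((Equiv.swap a b).trans σ)) := by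
  set σ' : Fin n ≃ R := (Equiv.swap a b).trans σ with hσ'
  -- Only the initial segment that separates `a` from `b` changes under the swap.
  have hpre : ∀ k : ℕ, k ≠ a + 1 → enumPrefix σ' k = enumPrefix σ k := by
    intro k hk
    ext c
    rw [mem_enumPrefix, mem_enumPrefix]
    simp only [hσ', Equiv.symm_trans_apply, Equiv.symm_swap]
    rw [Equiv.swap_apply_def]
    split_ifs with h1 h2
    · rw [h1]; omega
    · rw [h2]; omega
    · rfl
  have ha : σ a ∈ enumPrefix σ (a + 1) := by simp [mem_enumPrefix]
  have hb : σ b ∉ enumPrefix σ (a + 1) := by simp [mem_enumPrefix, hab]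
  have ha' : σ a ∉ enumPrefix σ' (a + 1) := by
    simp [mem_enumPrefix, hσ', hab]
  have hcard : (enumPrefix σ (a + 1)).card = a + 1 := card_enumPrefix σ a.2
  have hsub : ∀ Y ∈ (h.flag hn t σ : Set (ClassPoset cl)), Y ≠ face cl (enumPrefix σ (a + 1)) t →
      Y ∈ (h.flag hn t σ' : Set (ClassPoset cl)) := by
    rintro Y (rfl | ⟨k, hk, rfl⟩) hne
    · exact Or.inl rfl
    · refine Or.inr ⟨k, hk, ?_⟩
      rw [hpre k]
      rintro rfl
      exact hne rfl
  refine ⟨h.flag_isAdjacent hn (X := face cl (enumPrefix σ (a + 1)) t)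
    (Or.inr ⟨a + 1, a.2, rfl⟩) ?_ hsub, hσ, fun S hS => hsub S (hσ hS) ?_⟩
  · rw [h.face_mem_flag_iff hn]
    rintro ⟨h1, -⟩
    rw [hcard] at h1
    exact ha' (h1 ▸ ha)
  -- The lost face is not in `K`: its color set contains `σ a` and not `σ b`, whereas an initial
  -- segment of `τ` containing `σ a` contains the earlier `σ b`.
  · rintro rfl
    have h1 := ((h.face_mem_flag_iff hn).1 (hτ hS)).1
    rw [h1, mem_enumPrefix] at ha hb
    have := Fin.lt_def.1 hlt
    omega

/-- Bubble sort: exchanging neighbors that are out of order for `τ` lowers the sequence of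
`τ`-positions lexicographically, and without such neighbors the sequence is the identity. -/
theorem reflTransGen_adjacentOver (h : IsColorClassSystem cl) (hn : Fintype.card R = n) (t : V)
    {σ τ : Fin n ≃ R} {K : Set (ClassPoset cl)} (hσ : K ⊆ h.flag hn t σ)
    (hτ : K ⊆ h.flag hn t τ) :
    Relation.ReflTransGen (AdjacentOver K) (h.flag hn t σ) (h.flag hn t τ) := by
  generalize hf : toLex (fun i => τ.symm (σ i)) = f
  induction f using WellFoundedLT.induction generalizing σ with
  | ind f ih =>
    by_cases hex : ∃ a b : Fin n, (b : ℕ) = a + 1 ∧ τ.symm (σ b) < τ.symm (σ a)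
    · obtain ⟨a, b, hab, hlt⟩ := hex
      have hadj := h.adjacentOver_swap hn t hab hlt hσ hτ
      refine Relation.ReflTransGen.head hadj (ih _ ?_ hadj.2.2 rfl)
      rw [← hf]
      exact Pi.lex_desc (f := fun i => τ.symm (σ i)) (i := a) (j := b)
        (Fin.le_def.2 (by omega)) hlt
    · have hid : (fun i => τ.symm (σ i)) = id := by
        apply StrictMono.eq_id
        cases n with
        | zero => exact fun i => i.elim0
        | succ m =>
          rw [Fin.strictMono_iff_lt_succ]
          intro i
          refine lt_of_le_of_ne (le_of_not_gt fun hlt => hex ⟨_, _, by simp, hlt⟩) ?_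
          intro he
          have := σ.injective (τ.symm.injective he)
          exact absurd this i.castSucc_lt_succ.ne
      have : σ = τ := by
        ext i
        rw [← Equiv.symm_apply_eq]
        exact congrFun hid i
      rw [this]

/-- Two flags can be chosen that differ exactly in the vertex. -/
theorem exists_adjacentOver_vertex (h : IsColorClassSystem cl) (hn : Fintype.card R = n)
    {K : Set (ClassPoset cl)} (hK : IsChain (· ≤ ·) K) {s t : V} {c : R} (hs : s ∈ cl {c} t)
    (hst : s ≠ t) (hc : ∀ C, face cl C t ∈ K → c ∈ C)
    (ht : ∀ S ∈ K, S ≠ empty cl → t ∈ S.1) :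
    ∃ σ : Fin n ≃ R, AdjacentOver K (h.flag hn t σ) (h.flag hn s σ) := by
  have hle : ∀ S ∈ K, S ≠ empty cl → face cl {c} t ≤ S := by
    intro S hS he
    obtain ⟨C, rfl⟩ := h.eq_face_of_mem (ht S hS he)
    exact h.face_le_face_iff'.2 (Finset.singleton_subset_iff.2 (hc C hS))
  have hch : IsChain (· ≤ ·) (insert (face cl {c} t) K) := by
    refine hK.insert fun S hS _ => ?_
    by_cases he : S = empty cl
    · exact Or.inr (he ▸ empty_le _)
    · exact Or.inl (hle S hS he)
  obtain ⟨σ, hσ⟩ := h.exists_subset_flag hn hch t (by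
    rintro S (rfl | hS) he
    · exact h.mem_self _ _
    · exact ht S hS he)
  -- The edge with color `c` was added to the chain to force `c` to come first in `σ`; hence every
  -- face of positive rank in the flag contains `s` as well.
  have h1 : {c} = enumPrefix σ 1 :=
    ((h.face_mem_flag_iff hn).1 (hσ (Set.mem_insert _ _))).1
  have hsub : ∀ Y ∈ (h.flag hn t σ : Set (ClassPoset cl)), Y ≠ face cl ∅ t →
      Y ∈ (h.flag hn s σ : Set (ClassPoset cl)) := by
    rintro Y (rfl | ⟨k, hk, rfl⟩) hne
    · exact Or.inl rfl
    · refine Or.inr ⟨k, hk, (h.face_eq_of_mem ?_).symm⟩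
      rcases Nat.eq_zero_or_pos k with rfl | hk0
      · exact absurd (by rw [enumPrefix_zero]) hne
      · exact h.subset_iff.2 (h1 ▸ enumPrefix_mono σ hk0) hs
  have hKσ : K ⊆ h.flag hn t σ := (Set.subset_insert _ _).trans hσ
  refine ⟨σ, h.flag_isAdjacent hn (X := face cl ∅ t) ?_ ?_ hsub, hKσ, fun S hS => ?_⟩
  · exact Or.inr ⟨0, Nat.zero_le _, by rw [enumPrefix_zero]⟩
  · rw [h.face_mem_flag_iff hn, h.empty_eq]
    exact fun h2 => hst h2.2
  · refine hsub S (hKσ hS) ?_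
    rintro rfl
    exact absurd (hc ∅ hS) (Finset.notMem_empty c)

theorem strongly_flag_connected (h : IsColorClassSystem cl) [Nonempty V]
    (hn : Fintype.card R = n) (Φ Ψ : Flag (ClassPoset cl)) :
    Relation.ReflTransGen (AdjacentOver ((Φ : Set (ClassPoset cl)) ∩ Ψ)) Φ Ψ := by
  obtain ⟨t, σ, rfl⟩ := h.exists_eq_flag hn Φ
  obtain ⟨t', τ, rfl⟩ := h.exists_eq_flag hn Ψ
  set K := (h.flag hn t σ : Set (ClassPoset cl)) ∩ h.flag hn t' τ with hKdef
  have hKσ : K ⊆ h.flag hn t σ := Set.inter_subset_left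
  have hKτ : K ⊆ h.flag hn t' τ := Set.inter_subset_right
  have hK : IsChain (· ≤ ·) K := (h.flag hn t σ).Chain'.mono hKσ
  -- the smallest nonempty common face
  have hne : ∃ m : ℕ, ∃ C, face cl C t ∈ K ∧ C.card = m := by
    refine ⟨_, Finset.univ, ⟨(h.face_mem_flag_iff hn).2 ?_, (h.face_mem_flag_iff hn).2 ?_⟩, rfl⟩
    · rw [Finset.card_univ, hn, enumPrefix_self]
      exact ⟨rfl, h.mem_self _ _⟩
    · rw [Finset.card_univ, hn, enumPrefix_self, h.univ_eq]
      exact ⟨rfl, Set.mem_univ _⟩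
  classical
  obtain ⟨C, hC, hm⟩ := Nat.find_spec hne
  have ht : ∀ S ∈ K, S ≠ empty cl → t ∈ S.1 := by
    intro S hS he
    obtain ⟨k, hk, rfl⟩ := Or.resolve_left (hKσ hS) he
    exact h.mem_self _ _
  have hmin : ∀ D, face cl D t ∈ K → C ⊆ D := by
    intro D hD
    rcases hK.total hC hD with hle | hle
    · exact h.face_le_face_iff'.1 hle
    · have h1 := Nat.find_min' hne ⟨D, hD, rfl⟩
      exact (Finset.eq_of_subset_of_card_le (h.face_le_face_iff'.1 hle) (by omega)).superset
  have hpath : Relation.ReflTransGen (fun a b => ∃ c ∈ C, b ∈ cl {c} a) t t' :=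
    h.reflTransGen ((h.face_mem_flag_iff hn).1 (hKτ hC)).2
  -- Induction along the path: it stays in the class of `t` for `C`, which lies in every nonempty
  -- member of `K`, so each intermediate vertex carries flags containing `K`.
  have hgoal : ∀ s, Relation.ReflTransGen (fun a b => ∃ c ∈ C, b ∈ cl {c} a) t s →
      s ∈ cl C t ∧ ∀ ρ : Fin n ≃ R, K ⊆ h.flag hn s ρ →
        Relation.ReflTransGen (AdjacentOver K) (h.flag hn t σ) (h.flag hn s ρ) := by
    intro s hs
    induction hs with
    | refl => exact ⟨h.mem_self _ _, fun ρ hρ => h.reflTransGen_adjacentOver hn t hKσ hρ⟩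
    | @tail s s' _ hstep ih =>
      obtain ⟨c, hc, hss'⟩ := hstep
      by_cases he : s' = s
      · rwa [he]
      have hKs : ∀ D, face cl D s ∈ K → face cl D t ∈ K ∧ C ⊆ D := by
        intro D hD
        have h1 := ht _ hD (h.face_ne_empty _ _)
        rw [← h.face_eq_of_mem h1] at hD
        exact ⟨hD, hmin D hD⟩
      have hs : ∀ S ∈ K, S ≠ empty cl → s ∈ S.1 := by
        intro S hS hSe
        obtain ⟨D, rfl⟩ := h.eq_face_of_mem (ht S hS hSe)
        exact h.subset_iff.2 (hmin D hS) ih.1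
      obtain ⟨ρ', hadj⟩ := h.exists_adjacentOver_vertex hn hK hss' he
        (fun D hD => (hKs D hD).2 hc) hs
      refine ⟨?_, fun ρ hρ => ?_⟩
      · rw [← h.eq_of_mem ih.1]
        exact h.subset_iff.2 (Finset.singleton_subset_iff.2 hc) hss'
      · exact ((ih.2 ρ' hadj.2.1).tail hadj).trans
          (h.reflTransGen_adjacentOver hn s' hadj.2.2 hρ)
  exact (hgoal t' hpath).2 τ hKτ

/-- If `F` is empty, `G` is a one-color class and its two vertices lie between. Otherwise the
intermediate faces arise by adding one of the two colors of `G` missing from `F`. -/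
theorem diamond (h : IsColorClassSystem cl) (F G : ClassPoset cl) (hFG : F < G)
    (hr : rank cl G = rank cl F + 2) :
    {H | rank cl H = rank cl F + 1 ∧ F < H ∧ H < G}.ncard = 2 := by
  classical
  rw [Set.ncard_eq_two]
  have hsm := h.rank_strictMono
  rcases eq_empty_or_face F with rfl | ⟨C, t, rfl⟩
  · obtain ⟨D, t, rfl⟩ : ∃ D t, G = face cl D t :=
      (eq_empty_or_face G).resolve_left fun he => hFG.ne he.symm
    rw [h.rank_face, h.rank_empty] at hr
    obtain ⟨c, rfl⟩ := Finset.card_eq_one.1 (by omega : D.card = 1)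
    obtain ⟨s, hst, hs⟩ := h.exists_singleton_eq c t
    refine ⟨face cl ∅ t, face cl ∅ s, ?_, ?_⟩
    · intro he
      have : (face cl ∅ t).1 = (face cl ∅ s).1 := by rw [he]
      have h2 : ({t} : Set V) = {s} := by rw [← h.empty_eq, ← h.empty_eq]; exact this
      exact hst (Set.singleton_eq_singleton_iff.1 h2).symm
    · ext H
      simp only [Set.mem_ofPred_eq, Set.mem_insert_iff, Set.mem_singleton_iff]
      constructor
      · rintro ⟨h1, -, h3⟩
        rcases eq_empty_or_face H with rfl | ⟨E, u, rfl⟩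
        · rw [h.rank_empty] at h1; omega
        · rw [h.rank_face, h.rank_empty] at h1
          obtain rfl := Finset.card_eq_zero.1 (by omega : E.card = 0)
          have h4 := (h.face_le_face_iff.1 h3.le).2
          rw [hs] at h4
          rcases h4 with rfl | rfl
          · exact Or.inl rfl
          · exact Or.inr rfl
      · have key : ∀ u ∈ cl {c} t, rank cl (face cl ∅ u) = rank cl (empty cl) + 1 ∧
            empty cl < face cl ∅ u ∧ face cl ∅ u < face cl {c} t := by
          intro u hu
          refine ⟨?_, ?_, ?_⟩
          · rw [h.rank_face, h.rank_empty]; simp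
          · exact lt_of_le_of_ne (empty_le _) (h.face_ne_empty _ _).symm
          · refine lt_of_le_of_ne (h.face_le_face_iff.2 ⟨Finset.empty_subset _, hu⟩) fun he => ?_
            have := h.color_eq (congrArg Subtype.val he)
            exact Finset.singleton_ne_empty c this.symm
        rintro (rfl | rfl)
        · exact key _ (h.mem_self _ _)
        · exact key _ (by rw [hs]; exact Or.inr rfl)
  · obtain ⟨D, rfl⟩ := h.eq_face_of_mem (hFG.le (h.mem_self C t))
    rw [h.rank_face, h.rank_face] at hr
    have hCD := h.face_le_face_iff'.1 hFG.le
    have hcard : (D \ C).card = 2 := by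
      rw [Finset.card_sdiff_of_subset hCD]; omega
    obtain ⟨a, b, hab, hDC⟩ := Finset.card_eq_two.1 hcard
    have hmem : ∀ x, x ∈ D \ C ↔ x = a ∨ x = b := by
      intro x; rw [hDC]; simp
    have haC := Finset.mem_sdiff.1 ((hmem a).2 (Or.inl rfl))
    have hbC := Finset.mem_sdiff.1 ((hmem b).2 (Or.inr rfl))
    refine ⟨face cl (insert a C) t, face cl (insert b C) t, ?_, ?_⟩
    · intro he
      have h1 : insert a C = insert b C := h.color_eq (congrArg Subtype.val he)
      have h2 : a ∈ insert b C := h1 ▸ Finset.mem_insert_self a C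
      rcases Finset.mem_insert.1 h2 with h3 | h3
      · exact hab h3
      · exact haC.2 h3
    · ext H
      simp only [Set.mem_ofPred_eq, Set.mem_insert_iff, Set.mem_singleton_iff]
      constructor
      · rintro ⟨h1, h2, h3⟩
        obtain ⟨E, rfl⟩ := h.eq_face_of_mem (h2.le (h.mem_self C t))
        have h4 := h.face_le_face_iff'.1 h2.le
        have h5 := h.face_le_face_iff'.1 h3.le
        rw [h.rank_face, h.rank_face] at h1
        obtain ⟨x, hxC, rfl⟩ : ∃ x, x ∉ C ∧ insert x C = E :=
          (Finset.covBy_iff_exists_insert.1 (Finset.covBy_iff_card_sdiff_eq_one.2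
            ⟨h4, by rw [Finset.card_sdiff_of_subset h4]; omega⟩))
        rcases (hmem x).1 (Finset.mem_sdiff.2 ⟨h5 (Finset.mem_insert_self x C), hxC⟩) with
          rfl | rfl
        · exact Or.inl rfl
        · exact Or.inr rfl
      · have key : ∀ x ∈ D, x ∉ C → rank cl (face cl (insert x C) t) = rank cl (face cl C t) + 1 ∧
            face cl C t < face cl (insert x C) t ∧ face cl (insert x C) t < face cl D t := by
          intro x hxD hxC
          have hc := Finset.card_insert_of_notMem hxC
          refine ⟨?_, ?_, ?_⟩
          · rw [h.rank_face, h.rank_face, hc]; push_cast; ring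
          · refine lt_of_le_of_ne (h.face_le_face_iff'.2 (Finset.subset_insert _ _)) fun he => ?_
            have := congrArg Finset.card (h.color_eq (congrArg Subtype.val he))
            omega
          · refine lt_of_le_of_ne (h.face_le_face_iff'.2 (Finset.insert_subset hxD hCD)) fun he => ?_
            have := congrArg Finset.card (h.color_eq (congrArg Subtype.val he))
            omega
        rintro (rfl | rfl)
        · exact key _ haC.1 haC.2
        · exact key _ hbC.1 hbC.2

theorem vertexFigure (h : IsColorClassSystem cl) (hn : Fintype.card R = n) (F : ClassPoset cl)
    (hF : rank cl F = 0) : Nonempty (Set.Ici F ≃o Finset (Fin n)) := by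
  obtain ⟨C, t, rfl⟩ : ∃ C t, F = face cl C t := by
    refine (eq_empty_or_face F).resolve_left ?_
    rintro rfl
    rw [h.rank_empty] at hF
    omega
  rw [h.rank_face] at hF
  obtain rfl := Finset.card_eq_zero.1 (by omega : C.card = 0)
  let e : Fin n ≃ R := (Fintype.equivFinOfCardEq hn).symm
  let f : Finset (Fin n) ↪o Set.Ici (face cl ∅ t) :=
    OrderEmbedding.ofMapLEIff
      (fun A => ⟨face cl (A.map e.toEmbedding) t, h.face_le_face_iff'.2 (Finset.empty_subset _)⟩)
      (fun A B => by
        rw [← Subtype.coe_le_coe, h.face_le_face_iff', Finset.map_subset_map])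
  refine ⟨(RelIso.ofSurjective f ?_).symm⟩
  rintro ⟨S, hS⟩
  obtain ⟨D, rfl⟩ := h.eq_face_of_mem (hS (h.mem_self ∅ t))
  refine ⟨D.map e.symm.toEmbedding, Subtype.ext ?_⟩
  change face cl ((D.map e.symm.toEmbedding).map e.toEmbedding) t = face cl D t
  congr 1
  rw [Finset.map_map]
  ext x
  simp

theorem isSimpleAbstractPolytope (h : IsColorClassSystem cl) [Nonempty V]
    (hn : Fintype.card R = n) : IsSimpleAbstractPolytope n (rank cl) where
  strictMono := h.rank_strictMono
  range_eq := by
    refine Set.Subset.antisymm ?_ ?_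
    · rintro _ ⟨S, rfl⟩
      exact h.rank_mem_Icc hn S
    · rw [← h.rank_image_flagSet (Classical.arbitrary V) (Fintype.equivFinOfCardEq hn).symm]
      exact Set.image_subset_range _ _
  exists_least := ⟨empty cl, h.rank_empty, empty_le⟩
  exists_greatest := by
    refine ⟨face cl Finset.univ (Classical.arbitrary V), ?_, fun S => ?_⟩
    · rw [h.rank_face, Finset.card_univ, hn]
    · change S.1 ⊆ cl _ _
      rw [h.univ_eq]
      exact Set.subset_univ _
  flag_ncard := fun Φ => by
    obtain ⟨t, σ, rfl⟩ := h.exists_eq_flag hn Φ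
    exact h.flag_ncard hn t σ
  strongly_flag_connected := h.strongly_flag_connected hn
  diamond := h.diamond
  vertexFigure := h.vertexFigure hn

/-- The classes with a single color are the edges of a graph isomorphic to the `1`-skeleton. -/
theorem exists_oneSkeletonIso (h : IsColorClassSystem cl) (G : SimpleGraph V)
    (hG : ∀ s t, G.Adj t s ↔ s ≠ t ∧ ∃ c, cl {c} t = {t, s}) :
    ∃ φ : OneSkeletonIso G (rank cl),
      (∀ t : V, ((φ.vertexEquiv t : ClassPoset cl) : Set V) = {t}) ∧
      (∀ e : G.edgeSet, ((φ.edgeEquiv e : ClassPoset cl) : Set V) = {t | t ∈ (e : Sym2 V)}) := by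
  have hedge : ∀ e : G.edgeSet, ∃ c t, {t | t ∈ (e : Sym2 V)} = cl {c} t := by
    rintro ⟨e, he⟩
    induction e using Sym2.ind with
    | _ t s =>
      obtain ⟨-, c, hc⟩ := (hG s t).1 he
      refine ⟨c, t, ?_⟩
      rw [hc]
      ext u
      simp
  let fv : V → {F : ClassPoset cl // rank cl F = 0} := fun t =>
    ⟨⟨{t}, Or.inr ⟨∅, t, (h.empty_eq t).symm⟩⟩, by
      have : (⟨{t}, Or.inr ⟨∅, t, (h.empty_eq t).symm⟩⟩ : ClassPoset cl) = face cl ∅ t :=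
        Subtype.ext (h.empty_eq t).symm
      rw [this, h.rank_face]; simp⟩
  have hfv : Function.Bijective fv := by
    constructor
    · intro s t hst
      exact Set.singleton_eq_singleton_iff.1 (congrArg (fun F => F.1.1) hst)
    · rintro ⟨S, hS⟩
      rcases eq_empty_or_face S with rfl | ⟨C, t, rfl⟩
      · rw [h.rank_empty] at hS; omega
      · rw [h.rank_face] at hS
        obtain rfl := Finset.card_eq_zero.1 (by omega : C.card = 0)
        exact ⟨t, Subtype.ext (Subtype.ext (h.empty_eq t).symm)⟩
  let fe : G.edgeSet → {F : ClassPoset cl // rank cl F = 1} := fun e =>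
    ⟨⟨{t | t ∈ (e : Sym2 V)}, Or.inr (let ⟨c, t, hc⟩ := hedge e; ⟨{c}, t, hc⟩)⟩, by
      obtain ⟨c, t, hc⟩ := hedge e
      rw [show (⟨{t | t ∈ (e : Sym2 V)}, _⟩ : ClassPoset cl) = face cl {c} t from Subtype.ext hc,
        h.rank_face]
      simp⟩
  have hfe : Function.Bijective fe := by
    constructor
    · intro e e' hee
      have h1 : {t | t ∈ (e : Sym2 V)} = {t | t ∈ (e' : Sym2 V)} :=
        congrArg (fun F => F.1.1) hee
      exact Subtype.ext (Sym2.ext fun t => Set.ext_iff.1 h1 t)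
    · rintro ⟨S, hS⟩
      rcases eq_empty_or_face S with rfl | ⟨C, t, rfl⟩
      · rw [h.rank_empty] at hS; omega
      · rw [h.rank_face] at hS
        obtain ⟨c, rfl⟩ := Finset.card_eq_one.1 (by omega : C.card = 1)
        obtain ⟨s, hst, hs⟩ := h.exists_singleton_eq c t
        refine ⟨⟨s(t, s), (hG s t).2 ⟨hst, c, hs⟩⟩, Subtype.ext (Subtype.ext ?_)⟩
        change {u | u ∈ s(t, s)} = cl {c} t
        rw [hs]
        ext u
        simp
  refine ⟨⟨Equiv.ofBijective fv hfv, Equiv.ofBijective fe hfe, fun v e => ?_⟩,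
    fun t => rfl, fun e => rfl⟩
  exact Set.singleton_subset_iff.symm

end IsColorClassSystem

/-! ### Crossing diagonals of a convex polygon -/

/-- `a`, `b`, `c` are distinct and appear in this cyclic order. -/
def Cyc {m : ℕ} (a b c : Fin m) : Prop := (a < b ∧ b < c) ∨ (b < c ∧ c < a) ∨ (c < a ∧ a < b)

namespace Cyc

variable {m : ℕ} {a b c : Fin m}

/-- Numerical form of cyclic order, which lets `omega` settle such claims. -/
theorem iff_val : Cyc a b c ↔ (a.val < b.val ∧ b.val < c.val) ∨ (b.val < c.val ∧ c.val < a.val) ∨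
    (c.val < a.val ∧ a.val < b.val) := Iff.rfl

theorem rotate (h : Cyc a b c) : Cyc b c a := by rw [iff_val] at *; omega

theorem total (hab : a ≠ b) (hbc : b ≠ c) (hac : a ≠ c) : Cyc a b c ∨ Cyc c b a := by
  rw [iff_val, iff_val]; rw [Ne, Fin.ext_iff] at *; omega

theorem not_reverse (h : Cyc a b c) : ¬ Cyc c b a := by rw [iff_val] at *; omega

theorem ne (h : Cyc a b c) : a ≠ b ∧ b ≠ c ∧ a ≠ c := by
  simp only [Ne, Fin.ext_iff]; rw [iff_val] at *; omega

end Cyc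

/-! ### Orientation of triangles and intersection of segments -/

section Convex

variable {m : ℕ} {p : Fin m → EuclideanSpace ℝ (Fin 2)}

/-- Up to the orientation `ε`, triples in cyclic order are positively oriented. -/
theorem IsConvexPolygon.exists_sign (hp : IsConvexPolygon p) :
    ∃ ε : ℝ, ∀ a b c : Fin m, Cyc a b c → 0 < ε * signedArea2 (p a) (p b) (p c) := by
  have hrot : ∀ a b c, signedArea2 (p b) (p c) (p a) = signedArea2 (p a) (p b) (p c) := by
    intro a b c; simp only [signedArea2]; ring
  rcases hp with h | h
  · refine ⟨1, fun a b c habc => ?_⟩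
    rw [one_mul]
    rcases habc with h' | h' | h'
    · exact h _ _ _ h'.1 h'.2
    · rw [← hrot]; exact h _ _ _ h'.1 h'.2
    · rw [← hrot, ← hrot]; exact h _ _ _ h'.1 h'.2
  · refine ⟨-1, fun a b c habc => ?_⟩
    rw [neg_one_mul, neg_pos]
    rcases habc with h' | h' | h'
    · exact h _ _ _ h'.1 h'.2
    · rw [← hrot]; exact h _ _ _ h'.1 h'.2
    · rw [← hrot, ← hrot]; exact h _ _ _ h'.1 h'.2

theorem signedArea2_swap (a b c : EuclideanSpace ℝ (Fin 2)) :
    signedArea2 a c b = - signedArea2 a b c := by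
  simp only [signedArea2]; ring

theorem signedArea2_rotate (a b c : EuclideanSpace ℝ (Fin 2)) :
    signedArea2 b c a = signedArea2 a b c := by
  simp only [signedArea2]; ring

theorem signedArea2_self (a b : EuclideanSpace ℝ (Fin 2)) :
    signedArea2 a b a = 0 ∧ signedArea2 a b b = 0 := by
  simp only [signedArea2]; constructor <;> ring

theorem signedArea2_combo (a b c d : EuclideanSpace ℝ (Fin 2)) {u v : ℝ} (h : u + v = 1) :
    signedArea2 a b (u • c + v • d) = u * signedArea2 a b c + v * signedArea2 a b d := by
  obtain rfl : u = 1 - v := by linarith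
  simp only [signedArea2, PiLp.add_apply, PiLp.smul_apply, smul_eq_mul]; ring

/-- Segments whose endpoints separate each other meet. -/
theorem IsConvexPolygon.exists_mem_openSegment (hp : IsConvexPolygon p) {i j k l : Fin m}
    (hk : Cyc i k j) (hl : Cyc j l i) :
    ∃ x, x ∈ openSegment ℝ (p i) (p j) ∧ x ∈ openSegment ℝ (p k) (p l) := by
  obtain ⟨ε, hε⟩ := hp.exists_sign
  have h1 := hε _ _ _ hk
  have h2 := hε _ _ _ hl
  have h3 : 0 < ε * signedArea2 (p k) (p l) (p i) := by
    refine hε _ _ _ ?_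
    rw [Cyc.iff_val] at *; omega
  have h4 : 0 < ε * signedArea2 (p l) (p k) (p j) := by
    refine hε _ _ _ ?_
    rw [Cyc.iff_val] at *; omega
  set A := ε * signedArea2 (p i) (p k) (p j) with hA
  set B := ε * signedArea2 (p j) (p l) (p i) with hB
  set C := ε * signedArea2 (p k) (p l) (p i) with hC
  set D := ε * signedArea2 (p l) (p k) (p j) with hD
  -- Each side is proportional to the area of the quadrilateral, cut along one of its two diagonals.
  -- The weights below are ratios of these areas: a diagonal is divided in the ratio of the
  -- triangles at its ends.
  have hW : A + B = C + D := by
    simp only [hA, hB, hC, hD, signedArea2]; ring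
  have hpos : 0 < A + B := by linarith
  refine ⟨(D / (A + B)) • p i + (C / (A + B)) • p j,
    ⟨_, _, div_pos h4 hpos, div_pos h3 hpos, by field_simp; linarith, rfl⟩,
    ⟨B / (A + B), A / (A + B), div_pos h2 hpos, div_pos h1 hpos, by field_simp; ring, ?_⟩⟩
  ext t
  simp only [PiLp.add_apply, PiLp.smul_apply, smul_eq_mul]
  have key : B * p k t + A * p l t = D * p i t + C * p j t := by
    fin_cases t <;> simp only [hA, hB, hC, hD, signedArea2, Fin.zero_eta, Fin.mk_one] <;> ring
  calc _ = (B * p k t + A * p l t) / (A + B) := by ring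
    _ = (D * p i t + C * p j t) / (A + B) := by rw [key]
    _ = _ := by ring

/-- Segments whose endpoints do not separate each other are disjoint. -/
theorem IsConvexPolygon.cyc_of_mem_openSegment (hp : IsConvexPolygon p) {i j k l : Fin m}
    (hij : i ≠ j) (hkl : k ≠ l) (hne : s(i, j) ≠ s(k, l)) {x : EuclideanSpace ℝ (Fin 2)}
    (hx : x ∈ openSegment ℝ (p i) (p j)) (hx' : x ∈ openSegment ℝ (p k) (p l)) :
    (Cyc i k j ∧ Cyc j l i) ∨ (Cyc i l j ∧ Cyc j k i) := by
  obtain ⟨ε, hε⟩ := hp.exists_sign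
  -- The sign of the area over the line through `p i` and `p j` tells on which arc `y` lies; it
  -- vanishes only at the endpoints.
  have hside : ∀ y, (y = i ∨ y = j) ∧ ε * signedArea2 (p i) (p j) (p y) = 0 ∨
      Cyc i y j ∧ ε * signedArea2 (p i) (p j) (p y) < 0 ∨
      Cyc j y i ∧ 0 < ε * signedArea2 (p i) (p j) (p y) := by
    intro y
    by_cases h1 : y = i
    · rw [h1, (signedArea2_self _ _).1]; simp
    by_cases h2 : y = j
    · rw [h2, (signedArea2_self _ _).2]; simp
    rcases Cyc.total (Ne.symm h1) h2 hij with h3 | h3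
    · have := hε _ _ _ h3
      rw [signedArea2_swap] at this
      exact Or.inr (Or.inl ⟨h3, by linarith⟩)
    · have := hε _ _ _ h3
      rw [← signedArea2_rotate, ← signedArea2_rotate] at this
      exact Or.inr (Or.inr ⟨h3, this⟩)
  have h0 : ε * signedArea2 (p i) (p j) x = 0 := by
    obtain ⟨u, v, -, -, huv, rfl⟩ := hx
    rw [signedArea2_combo _ _ _ _ huv, (signedArea2_self _ _).1, (signedArea2_self _ _).2]
    ring
  obtain ⟨u, v, hu, hv, huv, rfl⟩ := hx'
  rw [signedArea2_combo _ _ _ _ huv] at h0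
  -- A positive combination of the areas at `k` and `l` vanishes, so they have opposite signs or are
  -- both zero; the latter would make the two pairs coincide.
  have h0' : u * (ε * signedArea2 (p i) (p j) (p k)) +
      v * (ε * signedArea2 (p i) (p j) (p l)) = 0 := by linarith
  rcases hside k with ⟨hk, hk'⟩ | ⟨hk, hk'⟩ | ⟨hk, hk'⟩ <;>
    rcases hside l with ⟨hl, hl'⟩ | ⟨hl, hl'⟩ | ⟨hl, hl'⟩
  · exfalso
    rcases hk with rfl | rfl <;> rcases hl with rfl | rfl
    · exact hkl rfl
    · exact hne rfl
    · exact hne Sym2.eq_swap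
    · exact hkl rfl
  · rw [hk'] at h0'; nlinarith [mul_pos hv (neg_pos.2 hl')]
  · rw [hk'] at h0'; nlinarith [mul_pos hv hl']
  · rw [hl'] at h0'; nlinarith [mul_pos hu (neg_pos.2 hk')]
  · nlinarith [mul_pos hu (neg_pos.2 hk'), mul_pos hv (neg_pos.2 hl')]
  · exact Or.inl ⟨hk, hl⟩
  · rw [hl'] at h0'; nlinarith [mul_pos hu hk']
  · exact Or.inr ⟨hl, hk⟩
  · nlinarith [mul_pos hu hk', mul_pos hv hl']

end Convex

/-! ### Crossing and sides in terms of cyclic order -/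

section Noncrossing

variable {n : ℕ}

/-- The set `D` of diagonals has no two members whose endpoints separate each other. -/
def CombNoncrossing (D : Set (Sym2 (Fin (n + 3)))) : Prop :=
  (∀ e ∈ D, IsDiagonal e) ∧
    ∀ i j k l, s(i, j) ∈ D → s(k, l) ∈ D → Cyc i k j → ¬ Cyc j l i

theorem isNoncrossing_iff {p : Fin (n + 3) → EuclideanSpace ℝ (Fin 2)} (hp : IsConvexPolygon p)
    (D : Set (Sym2 (Fin (n + 3)))) : IsNoncrossing p D ↔ CombNoncrossing D := by
  have hop : ∀ {i j i' j' : Fin (n + 3)}, s(i, j) = s(i', j') →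
      openSegment ℝ (p i) (p j) = openSegment ℝ (p i') (p j') := by
    intro i j i' j' h
    rcases Sym2.eq_iff.1 h with ⟨rfl, rfl⟩ | ⟨rfl, rfl⟩
    · rfl
    · exact openSegment_symm _ _ _
  refine and_congr_right fun hD => ?_
  constructor
  · intro h i j k l hij hkl hk hl
    obtain ⟨x, h1, h2⟩ := hp.exists_mem_openSegment hk hl
    have hne : s(i, j) ≠ s(k, l) := by
      intro he
      rcases Sym2.eq_iff.1 he with ⟨rfl, rfl⟩ | ⟨rfl, rfl⟩
      · exact hk.ne.1 rfl
      · exact hk.ne.2.1 rfl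
    exact Set.disjoint_left.1 (h hij hkl hne) ⟨i, j, rfl, h1⟩ ⟨k, l, rfl, h2⟩
  · intro h e he f hf hne
    refine Set.disjoint_left.2 ?_
    rintro x ⟨i, j, rfl, hx⟩ ⟨k, l, rfl, hx'⟩
    rcases hp.cyc_of_mem_openSegment (hD _ he).1 (hD _ hf).1 hne hx hx' with ⟨h1, h2⟩ | ⟨h1, h2⟩
    · exact h _ _ _ _ he hf h1 h2
    · exact h _ _ _ _ he (by rwa [Sym2.eq_swap]) h1 h2

theorem isTriangulation_iff {p : Fin (n + 3) → EuclideanSpace ℝ (Fin 2)} (hp : IsConvexPolygon p)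
    (D : Set (Sym2 (Fin (n + 3)))) : IsTriangulation p D ↔ Maximal CombNoncrossing D := by
  rw [IsTriangulation, funext fun D => propext (isNoncrossing_iff hp D)]

theorem isSide_iff {i j : Fin (n + 3)} (hij : i ≠ j) :
    IsSide s(i, j) ↔ (∀ k, ¬ Cyc i k j) ∨ ∀ k, ¬ Cyc j k i := by
  -- `j` follows `i` exactly when the open arc from `i` to `j` is empty; the case split treats the
  -- wrap-around at the last vertex.
  have key : ∀ {i j : Fin (n + 3)}, i ≠ j → (i + 1 = j ↔ ∀ k, ¬ Cyc i k j) := by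
    intro i j hij
    constructor
    · rintro rfl k hk
      rw [Cyc.iff_val, Fin.val_add_one] at hk
      split_ifs at hk with h
      · have := Fin.ext_iff.1 h
        rw [Fin.val_last] at this
        omega
      · omega
    · intro h
      by_contra hne
      refine h (i + 1) ?_
      rw [Fin.ext_iff, Fin.val_add_one] at hne
      rw [Ne, Fin.ext_iff] at hij
      rw [Cyc.iff_val, Fin.val_add_one]
      split_ifs at * with h
      · have := Fin.ext_iff.1 h
        rw [Fin.val_last] at this
        omega
      · rw [Fin.ext_iff, Fin.val_last] at h
        omega
  rw [← key hij, ← key hij.symm]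
  constructor
  · rintro ⟨k, hk⟩
    rcases Sym2.eq_iff.1 hk with ⟨rfl, rfl⟩ | ⟨rfl, rfl⟩
    · exact Or.inl rfl
    · exact Or.inr rfl
  · rintro (rfl | rfl)
    · exact ⟨i, rfl⟩
    · exact ⟨j, Sym2.eq_swap⟩

theorem isDiagonal_iff {i j : Fin (n + 3)} :
    IsDiagonal s(i, j) ↔ (∃ k, Cyc i k j) ∧ ∃ k, Cyc j k i := by
  rw [IsDiagonal, Sym2.mk_isDiag_iff]
  constructor
  · rintro ⟨h1, h2⟩
    rw [isSide_iff h1] at h2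
    push Not at h2
    exact h2
  · intro h
    have h1 : i ≠ j := h.1.choose_spec.ne.2.2
    refine ⟨h1, ?_⟩
    rw [isSide_iff h1]
    push Not
    exact h

end Noncrossing

/-! ### Triangulations as maximal noncrossing sets of diagonals -/

section Triangulation

variable {n : ℕ} {D : Set (Sym2 (Fin (n + 3)))}

/-- Sides of the polygon and members of `D`. -/
def EdgeOf (D : Set (Sym2 (Fin (n + 3)))) (e : Sym2 (Fin (n + 3))) : Prop := IsSide e ∨ e ∈ D

theorem Cyc.separate {m : ℕ} {i j k l : Fin m} (hk : Cyc i k j) (hl : Cyc j l i) :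
    Cyc k j l ∧ Cyc l i k := by
  simp only [Cyc.iff_val] at *; omega

theorem Cyc.trans_left {m : ℕ} {a b c d : Fin m} (h : Cyc a b c) (h' : Cyc c d a) :
    Cyc b d a := by
  simp only [Cyc.iff_val] at *; omega

theorem Cyc.trans_right {m : ℕ} {a b c d : Fin m} (h : Cyc a b c) (h' : Cyc c d a) :
    Cyc a b d := by
  simp only [Cyc.iff_val] at *; omega

theorem Cyc.eq_of_not {m : ℕ} {a b c x : Fin m} (hx : Cyc a x c)
    (h1 : ¬ Cyc a x b) (h2 : ¬ Cyc b x c) : x = b := by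
  rw [Fin.ext_iff]; simp only [Cyc.iff_val] at *; omega

theorem EdgeOf.swap {i j : Fin (n + 3)} (h : EdgeOf D s(i, j)) : EdgeOf D s(j, i) := by
  rwa [Sym2.eq_swap]

theorem CombNoncrossing.mono {D' : Set (Sym2 (Fin (n + 3)))} (h : CombNoncrossing D)
    (hsub : D' ⊆ D) : CombNoncrossing D' :=
  ⟨fun e he => h.1 e (hsub he), fun i j k l h1 h2 => h.2 i j k l (hsub h1) (hsub h2)⟩

theorem CombNoncrossing.insert_diagonal {k l : Fin (n + 3)} (h : CombNoncrossing D)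
    (hkl : IsDiagonal s(k, l)) (hD : ∀ a b, s(a, b) ∈ D → Cyc k a l → ¬ Cyc l b k) :
    CombNoncrossing (insert s(k, l) D) := by
  refine ⟨fun e he => ?_, ?_⟩
  · rcases he with rfl | he
    · exact hkl
    · exact h.1 e he
  · have hD' : ∀ a b a' b', s(a', b') = s(k, l) → s(a, b) ∈ D → Cyc a' a b' → ¬ Cyc b' b a' := by
      intro a b a' b' he hab h1 h2
      rcases Sym2.eq_iff.1 he with ⟨rfl, rfl⟩ | ⟨rfl, rfl⟩
      · exact hD a b hab h1 h2
      · exact hD b a (by rwa [Sym2.eq_swap]) h2 h1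
    rintro i j a b (h1 | h1) (h2 | h2) h3 h4
    · rcases Sym2.eq_iff.1 (h1.trans h2.symm) with ⟨rfl, rfl⟩ | ⟨rfl, rfl⟩
      · exact h3.ne.1 rfl
      · exact h3.ne.2.1 rfl
    · exact hD' a b i j h1 h2 h3 h4
    · obtain ⟨h5, h6⟩ := h3.separate h4
      exact hD' j i a b h2 (by rwa [Sym2.eq_swap]) h5 h6
    · exact h.2 i j a b h1 h2 h3 h4

/-- One of the arcs cut off by a side is empty, so sides cross nothing and may be treated like
diagonals. -/
theorem CombNoncrossing.edge (h : CombNoncrossing D) {i j k l : Fin (n + 3)}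
    (hij : EdgeOf D s(i, j)) (hkl : EdgeOf D s(k, l)) (h1 : Cyc i k j) (h2 : Cyc j l i) : False := by
  rcases hij with hij | hij
  · rcases (isSide_iff h1.ne.2.2).1 hij with h3 | h3
    · exact h3 _ h1
    · exact h3 _ h2
  · obtain ⟨h3, h4⟩ := h1.separate h2
    rcases hkl with hkl | hkl
    · rcases (isSide_iff h3.ne.2.2).1 hkl with h5 | h5
      · exact h5 _ h3
      · exact h5 _ h4
    · exact h.2 _ _ _ _ hij hkl h1 h2

theorem edgeOf_of_forall (h : Maximal CombNoncrossing D) {i j : Fin (n + 3)} (hij : i ≠ j)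
    (hD : ∀ a b, s(a, b) ∈ D → Cyc i a j → ¬ Cyc j b i) : EdgeOf D s(i, j) := by
  by_cases hs : IsSide s(i, j)
  · exact Or.inl hs
  · have h1 := h.prop.insert_diagonal ⟨by rwa [Sym2.mk_isDiag_iff], hs⟩ hD
    exact Or.inr (h.le_of_ge h1 (Set.subset_insert _ _) (Set.mem_insert _ _))

/-- Every edge with a vertex on its left has a triangle on its left. -/
theorem exists_apex (h : Maximal CombNoncrossing D) {i j : Fin (n + 3)}
    (hij : EdgeOf D s(i, j)) (hm : ∃ m, Cyc i m j) :
    ∃ k, Cyc i k j ∧ EdgeOf D s(i, k) ∧ EdgeOf D s(k, j) := by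
  obtain ⟨m, hm⟩ := hm
  -- Position in the cyclic order cut open at `i`: larger values lie farther from `i`.
  let f : Fin (n + 3) → ℕ := fun k => if i ≤ k then k else k + (n + 3)
  have hf : ∀ k k', f k ≤ f k' → ¬ Cyc i k' k := by
    intro k k' hle hc
    simp only [f] at hle
    simp only [Cyc.iff_val] at hc
    have := k.2; have := k'.2
    split_ifs at hle with h1 h2 h2 <;> simp only [Fin.le_def] at h1 h2 <;> omega
  have hne : {k | Cyc i k j ∧ EdgeOf D s(i, k)}.Nonempty := by
    have hi : i ≠ i + 1 := by simp
    refine ⟨i + 1, ?_, Or.inl ⟨i, rfl⟩⟩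
    have hval := Fin.val_add_one i
    have hlast : i = Fin.last (n + 2) ↔ i.val = n + 2 := by rw [Fin.ext_iff, Fin.val_last]
    rw [Cyc.iff_val] at *
    generalize i + 1 = s at hval hi ⊢
    simp only [hlast] at hval
    have := m.2; have := j.2
    split_ifs at hval with h1 <;> omega
  -- The apex is the neighbor of `i` on the arc farthest from `i`; `i + 1` shows that there is one.
  -- A diagonal crossing `k j` cannot cross `i j` or `i k`, so it ends at `i` and its other end is a
  -- farther neighbor.
  obtain ⟨k, ⟨hk, hik⟩, hmax⟩ := Set.exists_max_image _ f (Set.toFinite _) hne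
  refine ⟨k, hk, hik, edgeOf_of_forall h hk.ne.2.1 fun a b hab ha hb => ?_⟩
  have hab' : EdgeOf D s(a, b) := Or.inr hab
  have h1 : ¬ Cyc j b i := by
    refine fun h1 => h.prop.edge hij hab' ?_ h1
    rw [Cyc.iff_val] at *; omega
  have h2 : ¬ Cyc i b k := by
    refine fun h2 => h.prop.edge hik hab'.swap h2 ?_
    rw [Cyc.iff_val] at *; omega
  have h3 : b = i := by
    rw [Fin.ext_iff]
    rw [Cyc.iff_val] at *; omega
  subst h3
  refine hf a k (hmax a ⟨?_, hab'.swap⟩) ?_ <;> rw [Cyc.iff_val] at * <;> omega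

/-- Of two different triangles on the same side of an edge, some sides cross. -/
theorem apex_unique (h : CombNoncrossing D) {i j k k' : Fin (n + 3)}
    (hk : Cyc i k j) (hik : EdgeOf D s(i, k)) (hkj : EdgeOf D s(k, j))
    (hk' : Cyc i k' j) (hik' : EdgeOf D s(i, k')) (hkj' : EdgeOf D s(k', j)) : k = k' := by
  by_contra hne
  rw [Fin.ext_iff] at hne
  by_cases h1 : Cyc i k k'
  · refine h.edge hkj hik'.swap ?_ ?_ <;> rw [Cyc.iff_val] at * <;> omega
  · refine h.edge hkj' hik.swap ?_ ?_ <;> rw [Cyc.iff_val] at * <;> omega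

theorem isSide_zero_last : IsSide s((0 : Fin (n + 3)), Fin.last (n + 2)) :=
  ⟨Fin.last (n + 2), by rw [Fin.last_add_one, Sym2.eq_swap]⟩

/-- In the linear order of the labels, the only side passing over another vertex joins `0` to the
last vertex. -/
theorem EdgeOf.mem_insert_of_lt {i j k : Fin (n + 3)} (h : EdgeOf D s(i, j)) (hik : i < k)
    (hkj : k < j) : s(i, j) ∈ insert s(0, Fin.last (n + 2)) D := by
  refine h.imp (fun hs => ?_) id
  rcases (isSide_iff (hik.trans hkj).ne).1 hs with h1 | h1
  · exact absurd (Or.inl ⟨hik, hkj⟩) (h1 k)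
  · have h2 := h1 0
    have h3 := h1 (Fin.last _)
    simp only [Cyc.iff_val, Fin.val_zero, Fin.val_last] at h2 h3
    rw [Fin.lt_def] at hik hkj
    have hi : i = 0 := Fin.ext (by rw [Fin.val_zero]; omega)
    have hj : j = Fin.last _ := Fin.ext (by rw [Fin.val_last]; omega)
    rw [hi, hj]

/-- Take the shortest edge passing over `k`. If its apex were not `k`, one of the other two sides of
the triangle would be a shorter such edge. -/
theorem exists_edge_above (h : Maximal CombNoncrossing D) (k : Fin (n + 3)) (hk0 : 0 < k)
    (hk : k < Fin.last (n + 2)) :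
    ∃ i j, i < k ∧ k < j ∧ EdgeOf D s(i, j) ∧ EdgeOf D s(i, k) ∧ EdgeOf D s(k, j) := by
  obtain ⟨⟨i, j⟩, ⟨hik, hkj, hij⟩, hmin⟩ := Set.exists_min_image
    {q : Fin (n + 3) × Fin (n + 3) | q.1 < k ∧ k < q.2 ∧ EdgeOf D s(q.1, q.2)}
    (fun q => q.2.val - q.1.val) (Set.toFinite _)
    ⟨(0, Fin.last _), hk0, hk, Or.inl isSide_zero_last⟩
  obtain ⟨k', hk', h1, h2⟩ := exists_apex h hij ⟨k, Or.inl ⟨hik, hkj⟩⟩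
  refine ⟨i, j, hik, hkj, hij, ?_⟩
  dsimp only at hik hkj hk'
  have hval : i.val < k'.val ∧ k'.val < j.val := by
    rw [Cyc.iff_val] at hk'; rw [Fin.lt_def] at hik hkj; omega
  rcases lt_trichotomy k k' with hlt | rfl | hlt
  · have := hmin (i, k') ⟨hik, hlt, h1⟩
    dsimp only at this
    omega
  · exact ⟨h1, h2⟩
  · have := hmin (k', j) ⟨hlt, hkj, h2⟩
    dsimp only at this
    omega

/-- A triangulation of an `(n + 3)`-gon has `n` diagonals. -/
theorem ncard_of_maximal (h : Maximal CombNoncrossing D) : D.ncard = n := by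
  have hnot : s((0 : Fin (n + 3)), Fin.last (n + 2)) ∉ D := fun hm =>
    (h.prop.1 _ hm).2 isSide_zero_last
  -- Together with the long side there are `n + 1` edges, matched with the `n + 1` intermediate
  -- vertices: `k` goes to the side opposite it in the triangle where it is the middle vertex.
  suffices hs : (insert s((0 : Fin (n + 3)), Fin.last (n + 2)) D).ncard = n + 1 by
    rw [Set.ncard_insert_of_notMem hnot] at hs
    omega
  have hcard : (Set.Ioo (0 : Fin (n + 3)) (Fin.last (n + 2))).ncard = n + 1 := by
    rw [← Finset.coe_Ioo, Set.ncard_coe_finset, Fin.card_Ioo]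
    simp
  rw [← hcard]
  choose! f g hf hg hfg hfk hkg using
    fun (k : Fin (n + 3)) (hk : k ∈ Set.Ioo (0 : Fin (n + 3)) (Fin.last (n + 2))) =>
      exists_edge_above h k hk.1 hk.2
  -- Otherwise an edge at `k` of one triangle would cross the long edge of the other.
  have huniq : ∀ i j k, i < k → k < j → EdgeOf D s(i, j) → EdgeOf D s(i, k) → EdgeOf D s(k, j) →
      ∀ i' j', i' < k → k < j' → EdgeOf D s(i', j') → EdgeOf D s(i', k) → EdgeOf D s(k, j') →
      i ≤ i' ∧ j' ≤ j := by
    intro i j k hik hkj hij h1 h2 i' j' hik' hkj' hij' h1' h2'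
    constructor
    · by_contra hlt
      refine h.prop.edge h1'.swap hij.swap (i := k) (j := i') (k := j) (l := i) ?_ ?_ <;>
        rw [Cyc.iff_val] <;> simp only [Fin.lt_def, Fin.le_def] at * <;> omega
    · by_contra hlt
      refine h.prop.edge h2'.swap hij (i := j') (j := k) (k := i) (l := j) ?_ ?_ <;>
        rw [Cyc.iff_val] <;> simp only [Fin.lt_def, Fin.le_def] at * <;> omega
  symm
  refine Set.ncard_congr (fun k _ => s(f k, g k))
    (fun k hk => (hfg k hk).mem_insert_of_lt (hf k hk) (hg k hk)) ?_ ?_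
  · intro k k' hk hk' he
    rcases Sym2.eq_iff.1 he with ⟨h1, h2⟩ | ⟨h1, h2⟩
    · have hf' := hf k' hk'; have hg' := hg k' hk'
      have hfk' := hfk k' hk'; have hkg' := hkg k' hk'
      rw [← h1] at hf' hfk'
      rw [← h2] at hg' hkg'
      exact apex_unique h.prop (Or.inl ⟨hf k hk, hg k hk⟩) (hfk k hk) (hkg k hk)
        (Or.inl ⟨hf', hg'⟩) hfk' hkg'
    · have h3 := (hf k hk).trans (hg k hk)
      have h4 := (hf k' hk').trans (hg k' hk')
      rw [h1, h2] at h3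
      exact absurd h3 h4.not_gt
  · intro e he
    obtain ⟨i, j, rfl, hlt⟩ : ∃ i j, e = s(i, j) ∧ i < j := by
      induction e using Sym2.ind with
      | _ i j =>
        have hne : i ≠ j := by
          rcases he with he | he
          · rintro rfl
            rcases Sym2.eq_iff.1 he with ⟨h1, h2⟩ | ⟨h1, h2⟩ <;>
              · have := congrArg Fin.val (h1.symm.trans h2)
                simp at this
          · exact (Sym2.mk_isDiag_iff.not.1 (h.prop.1 _ he).1)
        rcases lt_or_gt_of_ne hne with hlt | hlt
        · exact ⟨i, j, rfl, hlt⟩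
        · exact ⟨j, i, Sym2.eq_swap, hlt⟩
    have hij : EdgeOf D s(i, j) := by
      rcases he with he | he
      · rw [he]; exact Or.inl isSide_zero_last
      · exact Or.inr he
    have hm : ∃ m, Cyc i m j := by
      rcases he with he | he
      · rcases Sym2.eq_iff.1 he with ⟨rfl, rfl⟩ | ⟨rfl, rfl⟩
        · refine ⟨⟨1, by omega⟩, ?_⟩
          rw [Cyc.iff_val]
          simp
        · exact absurd hlt (Fin.le_last _).not_gt
      · exact (isDiagonal_iff.1 (h.prop.1 _ he)).1
    obtain ⟨k, hk, h1, h2⟩ := exists_apex h hij hm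
    have hik : i < k ∧ k < j := by
      rw [Cyc.iff_val] at hk; simp only [Fin.lt_def] at *; omega
    have hkT : k ∈ Set.Ioo (0 : Fin (n + 3)) (Fin.last (n + 2)) :=
      ⟨(Fin.zero_le _).trans_lt hik.1, hik.2.trans_le (Fin.le_last _)⟩
    refine ⟨k, hkT, ?_⟩
    have a1 := huniq i j k hik.1 hik.2 hij h1 h2 _ _ (hf k hkT) (hg k hkT) (hfg k hkT)
      (hfk k hkT) (hkg k hkT)
    have a2 := huniq _ _ k (hf k hkT) (hg k hkT) (hfg k hkT) (hfk k hkT) (hkg k hkT) i j hik.1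
      hik.2 hij h1 h2
    rw [le_antisymm a1.1 a2.1, le_antisymm a2.2 a1.2]

/-- Any maximal extension also has `n` members, hence adds nothing. -/
theorem maximal_of_ncard (h : CombNoncrossing D) (hD : D.ncard = n) :
    Maximal CombNoncrossing D := by
  obtain ⟨D', hsub, hD'⟩ := (Set.toFinite {D : Set (Sym2 (Fin (n + 3))) |
    CombNoncrossing D}).exists_le_maximal h
  have he : D = D' := Set.eq_of_subset_of_ncard_le hsub
    (by rw [hD]; exact (ncard_of_maximal hD').le)
  rw [he]
  exact hD'

theorem exists_maximal_combNoncrossing (n : ℕ) :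
    ∃ D : Set (Sym2 (Fin (n + 3))), Maximal CombNoncrossing D := by
  have h : CombNoncrossing (∅ : Set (Sym2 (Fin (n + 3)))) := ⟨by simp, by simp⟩
  obtain ⟨D', -, hD'⟩ := (Set.toFinite {D : Set (Sym2 (Fin (n + 3))) |
    CombNoncrossing D}).exists_le_maximal h
  exact ⟨D', hD'⟩

/-- Third vertices of triangles on a common edge lie on different sides. -/
theorem cyc_of_triangles (h : CombNoncrossing D) {i j k l : Fin (n + 3)} (hij : i ≠ j)
    (hkl : k ≠ l) (hki : k ≠ i) (hkj : k ≠ j) (hli : l ≠ i) (hlj : l ≠ j)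
    (ik : EdgeOf D s(i, k)) (jk : EdgeOf D s(j, k)) (il : EdgeOf D s(i, l))
    (jl : EdgeOf D s(j, l)) : (Cyc i k j ∧ Cyc j l i) ∨ (Cyc j k i ∧ Cyc i l j) := by
  rcases Cyc.total hki.symm hkj hij with h1 | h1 <;> rcases Cyc.total hli.symm hlj hij with h2 | h2
  · exact absurd (apex_unique h h1 ik jk.swap h2 il jl.swap) hkl
  · exact Or.inl ⟨h1, h2⟩
  · exact Or.inr ⟨h1, h2⟩
  · exact absurd (apex_unique h h1 jk ik.swap h2 jl il.swap) hkl

/-- A diagonal crossing the new one but no side of the quadrilateral must join `i` and `j`, and that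
one is removed. -/
theorem CombNoncrossing.flip (h : CombNoncrossing D) {i j k l : Fin (n + 3)}
    (hk : Cyc i k j) (hl : Cyc j l i)
    (ik : EdgeOf D s(i, k)) (jk : EdgeOf D s(j, k)) (il : EdgeOf D s(i, l))
    (jl : EdgeOf D s(j, l)) : CombNoncrossing (insert s(k, l) (D \ {s(i, j)})) := by
  obtain ⟨h1, h2⟩ := hk.separate hl
  refine (h.mono Set.sdiff_subset).insert_diagonal (isDiagonal_iff.2 ⟨⟨_, h1⟩, ⟨_, h2⟩⟩) ?_
  rintro a b ⟨hab, hne⟩ ha hb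
  have hab' : EdgeOf D s(a, b) := Or.inr hab
  have haj : a = j := Cyc.eq_of_not ha (fun c => h.edge jk.swap hab' c (h1.trans_left hb))
    (fun c => h.edge jl hab' c (hb.trans_right h1))
  have hbi : b = i := Cyc.eq_of_not hb (fun c => h.edge il.swap hab'.swap c (h2.trans_left ha))
    (fun c => h.edge ik hab'.swap c (ha.trans_right h2))
  rw [haj, hbi] at hne
  exact hne Sym2.eq_swap

/-- The flip of a diagonal of a triangulation. -/
theorem maximal_flip (h : Maximal CombNoncrossing D) {i j k l : Fin (n + 3)}
    (hij : s(i, j) ∈ D) (hk : Cyc i k j) (hl : Cyc j l i)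
    (ik : EdgeOf D s(i, k)) (jk : EdgeOf D s(j, k)) (il : EdgeOf D s(i, l))
    (jl : EdgeOf D s(j, l)) :
    s(k, l) ∉ D ∧ Maximal CombNoncrossing (insert s(k, l) (D \ {s(i, j)})) := by
  have hnot : s(k, l) ∉ D := fun hm => h.prop.2 _ _ _ _ hij hm hk hl
  refine ⟨hnot, maximal_of_ncard (h.prop.flip hk hl ik jk il jl) ?_⟩
  rw [Set.ncard_insert_of_notMem (fun hm => hnot hm.1), Set.ncard_sdiff_singleton_add_one hij]
  exact ncard_of_maximal h

end Triangulation

/-! ### Flips of colored triangulations -/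

namespace ColoredTriangulation

variable {n : ℕ} {p : Fin (n + 3) → EuclideanSpace ℝ (Fin 2)} {R : Type*}

theorem maximal_supp (hp : IsConvexPolygon p) (t : ColoredTriangulation p R) :
    Maximal CombNoncrossing t.supp := (isTriangulation_iff hp _).1 t.isTriangulation

theorem IsEdge.symm {t : ColoredTriangulation p R} {i j : Fin (n + 3)} (h : t.IsEdge s(i, j)) :
    t.IsEdge s(j, i) := by rwa [Sym2.eq_swap]

/-- The `n` diagonals have distinct colors, and there are only `n` colors. -/
theorem exists_mem_color [Fintype R] (hp : IsConvexPolygon p) (hR : Fintype.card R = n)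
    (t : ColoredTriangulation p R) (c : R) : ∃ e, (e, c) ∈ t.diagonals := by
  have h1 : (Prod.snd '' t.diagonals).ncard = n := by
    rw [t.color_injective.ncard_image, ← t.color_unique.ncard_image]
    exact ncard_of_maximal (t.maximal_supp hp)
  have h2 : Prod.snd '' t.diagonals = Set.univ := by
    refine Set.eq_of_subset_of_ncard_le (Set.subset_univ _) ?_
    rw [h1, Set.ncard_univ, Nat.card_eq_fintype_card, hR]
  obtain ⟨⟨e, c'⟩, he, rfl⟩ : c ∈ Prod.snd '' t.diagonals := h2 ▸ Set.mem_univ c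
  exact ⟨e, he⟩

theorem color_inj {t : ColoredTriangulation p R} {e e' : Sym2 (Fin (n + 3))} {c : R}
    (h : (e, c) ∈ t.diagonals) (h' : (e', c) ∈ t.diagonals) : e = e' :=
  congrArg Prod.fst (t.color_injective h h' rfl)

theorem eq_of_forall_color [Fintype R] (hp : IsConvexPolygon p) (hR : Fintype.card R = n)
    {t t' : ColoredTriangulation p R} (h : t.diagonals ⊆ t'.diagonals) : t = t' := by
  refine ColoredTriangulation.ext (h.antisymm ?_)
  rintro ⟨e, c⟩ he
  obtain ⟨e', he'⟩ := t.exists_mem_color hp hR c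
  rwa [color_inj he (h he')]

/-- The two triangles on a diagonal lie on different sides of it. -/
theorem IsTriangle.cyc (hp : IsConvexPolygon p) {t : ColoredTriangulation p R}
    {i j k l : Fin (n + 3)} (hkl : k ≠ l) (hk : t.IsTriangle i j k) (hl : t.IsTriangle i j l) :
    (Cyc i k j ∧ Cyc j l i) ∨ (Cyc j k i ∧ Cyc i l j) :=
  cyc_of_triangles (t.maximal_supp hp).prop hk.1.ne hkl hk.2.2.ne.symm hk.2.1.ne.symm
    hl.2.2.ne.symm hl.2.1.ne.symm hk.2.2 hk.2.1 hl.2.2 hl.2.1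

theorem exists_flip (hp : IsConvexPolygon p) {t : ColoredTriangulation p R}
    {i j k l : Fin (n + 3)} {c : R} (hd : (s(i, j), c) ∈ t.diagonals) (hkl : k ≠ l)
    (hk : t.IsTriangle i j k) (hl : t.IsTriangle i j l) :
    ∃ t' : ColoredTriangulation p R,
      t'.diagonals = insert (s(k, l), c) (t.diagonals \ {(s(i, j), c)}) := by
  have hmem : s(i, j) ∈ t.supp := ⟨_, hd, rfl⟩
  obtain ⟨hnot, hmax⟩ : s(k, l) ∉ t.supp ∧
      Maximal CombNoncrossing (insert s(k, l) (t.supp \ {s(i, j)})) := by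
    rcases hk.cyc hp hkl hl with ⟨h1, h2⟩ | ⟨h1, h2⟩
    · exact maximal_flip (t.maximal_supp hp) hmem h1 h2 hk.2.2 hk.2.1 hl.2.2 hl.2.1
    · rw [Sym2.eq_swap (a := i)] at hmem ⊢
      exact maximal_flip (t.maximal_supp hp) hmem h1 h2 hk.2.1 hk.2.2 hl.2.1 hl.2.2
  have hfst : Prod.fst '' (insert (s(k, l), c) (t.diagonals \ {(s(i, j), c)})) =
      insert s(k, l) (t.supp \ {s(i, j)}) := by
    rw [Set.image_insert_eq, t.color_unique.image_sdiff_subset (Set.singleton_subset_iff.2 hd),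
      Set.image_singleton]
    rfl
  refine ⟨⟨_, by rw [hfst]; exact (isTriangulation_iff hp _).2 hmax, ?_, ?_⟩, rfl⟩
  · refine (Set.injOn_insert fun h => hnot ⟨_, h.1, ?_⟩).2
      ⟨t.color_unique.mono Set.sdiff_subset, ?_⟩
    · rfl
    · rintro ⟨x, hx, he⟩
      exact hnot ⟨x, hx.1, he⟩
  · refine (Set.injOn_insert fun h => hnot ⟨_, h.1, ?_⟩).2
      ⟨t.color_injective.mono Set.sdiff_subset, ?_⟩
    · rfl
    · rintro ⟨x, hx, he⟩
      exact hx.2 (t.color_injective hx.1 hd he)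

/-- A diagonal has vertices on both sides, hence by `exists_apex` a triangle on each. -/
theorem exists_isFlip [Fintype R] (hp : IsConvexPolygon p) (hR : Fintype.card R = n) (c : R)
    (t : ColoredTriangulation p R) : ∃ t', IsFlip c t t' := by
  obtain ⟨e, he⟩ := t.exists_mem_color hp hR c
  induction e using Sym2.ind with
  | _ i j =>
    have hmem : s(i, j) ∈ t.supp := ⟨_, he, rfl⟩
    have hij : t.IsEdge s(i, j) := Or.inr hmem
    obtain ⟨h1, h2⟩ := isDiagonal_iff.1 ((t.maximal_supp hp).prop.1 _ hmem)
    obtain ⟨k, hk, ik, kj⟩ := exists_apex (t.maximal_supp hp) hij h1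
    obtain ⟨l, hl, jl, li⟩ := exists_apex (t.maximal_supp hp) hij.symm h2
    have hkl : k ≠ l := by
      rintro rfl
      exact hk.not_reverse hl
    have hk' : t.IsTriangle i j k := ⟨hij, kj.swap, ik⟩
    have hl' : t.IsTriangle i j l := ⟨hij, jl, li.swap⟩
    obtain ⟨t', ht'⟩ := exists_flip hp he hkl hk' hl'
    exact ⟨t', i, j, k, l, he, hkl, hk', hl', ht'⟩

/-- A flip in normal form: the two triangles have prescribed orientations. -/
theorem IsFlip.exists_cyc (hp : IsConvexPolygon p) {c : R} {t t' : ColoredTriangulation p R}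
    (h : IsFlip c t t') {i j : Fin (n + 3)} (hd : (s(i, j), c) ∈ t.diagonals) :
    ∃ k l, Cyc i k j ∧ Cyc j l i ∧ t.IsTriangle i j k ∧ t.IsTriangle i j l ∧
      t'.diagonals = insert (s(k, l), c) (t.diagonals \ {(s(i, j), c)}) := by
  obtain ⟨a, b, k, l, hd', hkl, hk, hl, ht'⟩ := h
  have he := color_inj hd hd'
  have key : t.IsTriangle i j k ∧ t.IsTriangle i j l := by
    rcases Sym2.eq_iff.1 he with ⟨rfl, rfl⟩ | ⟨rfl, rfl⟩
    · exact ⟨hk, hl⟩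
    · exact ⟨⟨hk.1.symm, hk.2.2, hk.2.1⟩, ⟨hl.1.symm, hl.2.2, hl.2.1⟩⟩
  rw [← he] at ht'
  rcases key.1.cyc hp hkl key.2 with ⟨h1, h2⟩ | ⟨h1, h2⟩
  · exact ⟨k, l, h1, h2, key.1, key.2, ht'⟩
  · exact ⟨l, k, h2, h1, key.2, key.1, by rw [ht', Sym2.eq_swap]⟩

theorem IsFlip.unique (hp : IsConvexPolygon p) {c : R} {t t' t'' : ColoredTriangulation p R}
    (h : IsFlip c t t') (h' : IsFlip c t t'') : t' = t'' := by
  obtain ⟨i, j, -, -, hd, -⟩ := id h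
  obtain ⟨k, l, hk, hl, tk, tl, ht'⟩ := h.exists_cyc hp hd
  obtain ⟨k', l', hk', hl', tk', tl', ht''⟩ := h'.exists_cyc hp hd
  have hD := (t.maximal_supp hp).prop
  have h1 : k = k' := apex_unique hD hk tk.2.2 tk.2.1.symm hk' tk'.2.2 tk'.2.1.symm
  have h2 : l = l' := apex_unique hD hl tl.2.1 tl.2.2.symm hl' tl'.2.1 tl'.2.2.symm
  exact ColoredTriangulation.ext (by rw [ht', ht'', h1, h2])

theorem IsFlip.mem_iff {c c' : R} {t t' : ColoredTriangulation p R} (h : IsFlip c t t')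
    (hc : c' ≠ c) (e : Sym2 (Fin (n + 3))) : (e, c') ∈ t'.diagonals ↔ (e, c') ∈ t.diagonals := by
  obtain ⟨i, j, k, l, -, -, -, -, ht'⟩ := h
  rw [ht']
  simp [hc]

/-- The colors outside `C` do not move within `colorClass C t`. -/
theorem mem_iff_of_reachable {C : Set R} {c : R} (hc : c ∉ C) {t t' : ColoredTriangulation p R}
    (h : (flipGraph p C).Reachable t t') (e : Sym2 (Fin (n + 3))) :
    (e, c) ∈ t'.diagonals ↔ (e, c) ∈ t.diagonals := by
  rw [SimpleGraph.reachable_iff_reflTransGen] at h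
  induction h with
  | refl => rfl
  | tail _ hs ih =>
    obtain ⟨c', hc', hf⟩ := hs
    rw [← ih]
    exact hf.mem_iff (by rintro rfl; exact hc hc') e

/-! ### Connectedness of the exchange graph -/

/-- Performing a flip and keeping track of edges and colors. -/
theorem exists_adj (hp : IsConvexPolygon p) {t : ColoredTriangulation p R}
    {i j k l : Fin (n + 3)} {c : R} (hd : (s(i, j), c) ∈ t.diagonals) (hkl : k ≠ l)
    (ik : t.IsEdge s(i, k)) (jk : t.IsEdge s(j, k)) (il : t.IsEdge s(i, l))
    (jl : t.IsEdge s(j, l)) :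
    ∃ t' : ColoredTriangulation p R, (colorfulExchangeGraph p R).Adj t t' ∧
      (s(k, l), c) ∈ t'.diagonals ∧
      (∀ e c', c' ≠ c → (e, c') ∈ t.diagonals → (e, c') ∈ t'.diagonals) ∧
      (∀ e, e ≠ s(i, j) → t.IsEdge e → t'.IsEdge e) := by
  have hij : t.IsEdge s(i, j) := Or.inr ⟨_, hd, rfl⟩
  obtain ⟨t', ht'⟩ := exists_flip hp hd hkl ⟨hij, jk, ik⟩ ⟨hij, jl, il⟩
  have hf : IsFlip c t t' := ⟨i, j, k, l, hd, hkl, ⟨hij, jk, ik⟩, ⟨hij, jl, il⟩, ht'⟩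
  refine ⟨t', ⟨c, Set.mem_univ c, hf⟩, ?_, fun e c' hc' he => (hf.mem_iff hc' e).2 he, ?_⟩
  · rw [ht']
    exact Set.mem_insert _ _
  · rintro e hne (h | ⟨⟨e, c'⟩, h, rfl⟩)
    · exact Or.inl h
    · refine Or.inr ⟨(e, c'), ?_, rfl⟩
      rw [ht']
      exact Or.inr ⟨h, fun h' => hne (congrArg Prod.fst h')⟩

/-- Five flips in a pentagon exchange the colors of its two diagonals. -/
theorem exists_reachable_pentagon (hp : IsConvexPolygon p) {t : ColoredTriangulation p R}
    {v₀ v₁ v₂ v₃ v₄ : Fin (n + 3)} {x y : R} (hv : [v₀, v₁, v₂, v₃, v₄].Nodup)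
    (hx : (s(v₀, v₂), x) ∈ t.diagonals) (hy : (s(v₀, v₃), y) ∈ t.diagonals)
    (h01 : t.IsEdge s(v₀, v₁)) (h12 : t.IsEdge s(v₁, v₂)) (h23 : t.IsEdge s(v₂, v₃))
    (h34 : t.IsEdge s(v₃, v₄)) (h04 : t.IsEdge s(v₀, v₄)) :
    ∃ t' : ColoredTriangulation p R, (colorfulExchangeGraph p R).Reachable t t' ∧
      (s(v₀, v₃), x) ∈ t'.diagonals ∧ (s(v₀, v₂), y) ∈ t'.diagonals ∧
      ∀ e c, c ≠ x → c ≠ y → (e, c) ∈ t.diagonals → (e, c) ∈ t'.diagonals := by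
  simp only [List.nodup_cons, List.mem_cons, List.not_mem_nil, or_false, not_or] at hv
  obtain ⟨⟨n01, n02, n03, n04⟩, ⟨n12, n13, n14⟩, ⟨n23, n24⟩, n34, -⟩ := hv
  have hyx : y ≠ x := by
    rintro rfl
    have := color_inj hx hy
    simp [n23, n03] at this
  have edge : ∀ {t : ColoredTriangulation p R} {e c}, (e, c) ∈ t.diagonals → t.IsEdge e :=
    fun h => Or.inr ⟨_, h, rfl⟩
  -- The flipped diagonals are not sides of the pentagon, so its sides persist. The fifth flip needs
  -- no such record, as no flip follows it.
  have hne : ∀ d ∈ [s(v₀, v₂), s(v₀, v₃), s(v₁, v₃), s(v₁, v₄)],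
      ∀ e ∈ [s(v₀, v₁), s(v₁, v₂), s(v₂, v₃), s(v₃, v₄), s(v₀, v₄)], e ≠ d := by
    simp only [List.forall_mem_cons, List.not_mem_nil, false_imp_iff, implies_true, and_true, Ne,
      Sym2.eq_iff]
    grind
  have keep : ∀ d ∈ [s(v₀, v₂), s(v₀, v₃), s(v₁, v₃), s(v₁, v₄)],
      ∀ {t t' : ColoredTriangulation p R}, (∀ e, e ≠ d → t.IsEdge e → t'.IsEdge e) →
      (∀ e ∈ [s(v₀, v₁), s(v₁, v₂), s(v₂, v₃), s(v₃, v₄), s(v₀, v₄)], t.IsEdge e) →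
      ∀ e ∈ [s(v₀, v₁), s(v₁, v₂), s(v₂, v₃), s(v₃, v₄), s(v₀, v₄)], t'.IsEdge e :=
    fun d hd t t' h1 h2 e he => h1 e (hne d hd e he) (h2 e he)
  have hS : ∀ e ∈ [s(v₀, v₁), s(v₁, v₂), s(v₂, v₃), s(v₃, v₄), s(v₀, v₄)], t.IsEdge e := by
    simp [h01, h12, h23, h34, h04]
  -- Alternating flips: `x` goes from 02 to 13, `y` from 03 to 14, `x` to 24, `y` to 02, `x` to 03.
  obtain ⟨t1, a1, d1, c1, e1⟩ := exists_adj hp hx n13 h01 h12.symm (edge hy) h23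
  have hS1 := keep _ (by simp) e1 hS
  have hy1 := c1 _ _ hyx hy
  obtain ⟨t2, a2, d2, c2, e2⟩ := exists_adj hp hy1 n14 (hS1 _ (by simp)) (edge d1).symm
    (hS1 _ (by simp)) (hS1 _ (by simp))
  have hS2 := keep _ (by simp) e2 hS1
  have hx2 := c2 _ _ hyx.symm d1
  obtain ⟨t3, a3, d3, c3, e3⟩ := exists_adj hp hx2 n24 (hS2 _ (by simp))
    (IsEdge.symm (hS2 _ (by simp))) (edge d2) (hS2 _ (by simp))
  have hS3 := keep _ (by simp) e3 hS2
  have hy3 := c3 _ _ hyx d2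
  obtain ⟨t4, a4, d4, c4, e4⟩ := exists_adj hp hy3 n02 (IsEdge.symm (hS3 _ (by simp)))
    (IsEdge.symm (hS3 _ (by simp))) (hS3 _ (by simp)) (edge d3).symm
  have hS4 := keep _ (by simp) e4 hS3
  have hx4 := c4 _ _ hyx.symm d3
  obtain ⟨t5, a5, d5, c5, -⟩ := exists_adj hp hx4 n03 (edge d4).symm
    (IsEdge.symm (hS4 _ (by simp))) (hS4 _ (by simp)) (IsEdge.symm (hS4 _ (by simp)))
  refine ⟨t5, a1.reachable.trans (a2.reachable.trans (a3.reachable.trans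
    (a4.reachable.trans a5.reachable))), d5, c5 _ _ hyx d4, fun e c hcx hcy he => ?_⟩
  exact c5 _ _ hcx (c4 _ _ hcy (c3 _ _ hcx (c2 _ _ hcy (c1 _ _ hcx he))))

/-- As long as not all diagonals at the vertex `0` are present, their number can be increased by a
flip. -/
theorem exists_adj_ssubset (hp : IsConvexPolygon p) (t : ColoredTriangulation p R)
    (hex : ∃ v, v ≠ 0 ∧ ¬ t.IsEdge s(0, v)) :
    ∃ t' : ColoredTriangulation p R, (colorfulExchangeGraph p R).Adj t t' ∧
      {v | t.IsEdge s(0, v)} ⊂ {v | t'.IsEdge s(0, v)} := by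
  -- Let `v` be the first non-neighbor of `0` and `a` its predecessor, a neighbor. The triangle
  -- beyond `0 a` has an apex `b` past `v`; flipping `a b` joins `0` to the apex `k` on the other
  -- side.
  obtain ⟨v, ⟨hv0, hv⟩, hmin⟩ := Set.exists_min_image {v | v ≠ 0 ∧ ¬ t.IsEdge s(0, v)} id
    (Set.toFinite _) hex
  have hv0' : 0 < v.val := Nat.pos_of_ne_zero fun h => hv0 (Fin.ext h)
  have hvlast : v.val ≠ n + 2 := by
    intro h
    refine hv (Or.inl ?_)
    rw [show v = Fin.last (n + 2) from Fin.ext h]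
    exact isSide_zero_last
  have hvlt := v.2
  obtain ⟨a, ha⟩ : ∃ a : Fin (n + 3), a.val + 1 = v.val := ⟨⟨v.val - 1, by omega⟩, by simp; omega⟩
  have hav : a + 1 = v := by
    rw [Fin.ext_iff, Fin.val_add_one, if_neg, ha]
    rw [Fin.ext_iff, Fin.val_last]
    omega
  have ha0 : a ≠ 0 := by
    rintro rfl
    exact hv (Or.inl ⟨0, by rw [hav]⟩)
  have ha0' : 0 < a.val := Nat.pos_of_ne_zero fun h => ha0 (Fin.ext h)
  have ha' : t.IsEdge s(0, a) := by
    by_contra hna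
    have := hmin a ⟨ha0, hna⟩
    simp only [id, Fin.le_def] at this
    omega
  have hT := t.maximal_supp hp
  obtain ⟨b, hb, hab, hb0⟩ := exists_apex hT ha'.symm
    ⟨v, by simp only [Cyc.iff_val, Fin.val_zero]; omega⟩
  have hbv : b ≠ v := by
    rintro rfl
    exact hv hb0.swap
  have hbv' : v.val < b.val := by
    rw [Ne, Fin.ext_iff] at hbv
    simp only [Cyc.iff_val, Fin.val_zero] at hb
    omega
  have hcyc : Cyc a v b := Or.inl ⟨Fin.lt_def.2 (by omega), Fin.lt_def.2 hbv'⟩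
  have hD : s(a, b) ∈ t.supp := by
    refine Or.resolve_left hab fun hs => ?_
    rcases (isSide_iff hb.ne.1).1 hs with h1 | h1
    · exact h1 v hcyc
    · exact h1 0 hb.rotate
  obtain ⟨k, hk, ak, kb⟩ := exists_apex hT hab ⟨v, hcyc⟩
  obtain ⟨⟨e, c⟩, hc, rfl : e = s(a, b)⟩ := id hD
  have hk0 : k ≠ 0 := by
    rintro rfl
    exact hb.rotate.not_reverse hk
  obtain ⟨t', hadj, hmem, -, hedge⟩ := exists_adj hp hc hk0 ak kb.swap ha'.symm hb0
  refine ⟨t', hadj, fun u hu => hedge _ ?_ hu, fun hsub => ?_⟩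
  · intro he
    rcases Sym2.eq_iff.1 he with ⟨h1, -⟩ | ⟨h1, -⟩
    · exact ha0 h1.symm
    · exact hb.ne.2.1 h1.symm
  · have h1 : t.IsEdge s(0, k) := hsub (Or.inr ⟨_, hmem, Sym2.eq_swap⟩)
    exact hT.prop.edge hab h1.symm hk hb.rotate

/-! ### Fans at the vertex `0` and permutations of their colors -/

/-- The vertex `i + 2`, the endpoint of the `i`-th diagonal at the vertex `0`. -/
def fanVertex (i : Fin n) : Fin (n + 3) := ⟨i + 2, by omega⟩

theorem fanVertex_injective : Function.Injective (fanVertex : Fin n → Fin (n + 3)) := by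
  intro i j h
  have := congrArg Fin.val h
  simp only [fanVertex] at this
  exact Fin.ext (by omega)

/-- `t` consists of the diagonals at the vertex `0`, colored by `σ`. -/
def IsFan (t : ColoredTriangulation p R) (σ : Fin n ≃ R) : Prop :=
  ∀ i, (s(0, fanVertex i), σ i) ∈ t.diagonals

theorem IsFan.eq [Fintype R] (hp : IsConvexPolygon p) (hR : Fintype.card R = n)
    {t t' : ColoredTriangulation p R} {σ : Fin n ≃ R} (h : t.IsFan σ) (h' : t'.IsFan σ) :
    t = t' := by
  refine eq_of_forall_color hp hR ?_
  rintro ⟨e, c⟩ he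
  obtain ⟨i, rfl⟩ := σ.surjective c
  rw [color_inj he (h i)]
  exact h' i

theorem IsFan.isEdge {t : ColoredTriangulation p R} {σ : Fin n ≃ R} (h : t.IsFan σ)
    {v : Fin (n + 3)} (hv : v ≠ 0) : t.IsEdge s(0, v) := by
  have hv0 : 0 < v.val := Nat.pos_of_ne_zero fun h => hv (Fin.ext h)
  have hvlt := v.2
  by_cases h1 : v.val = 1
  · exact Or.inl ⟨0, by rw [show v = 0 + 1 from Fin.ext (by simp [h1])]⟩
  by_cases h2 : v.val = n + 2
  · rw [show v = Fin.last (n + 2) from Fin.ext h2]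
    exact Or.inl isSide_zero_last
  · refine Or.inr ⟨_, h ⟨v.val - 2, by omega⟩, ?_⟩
    exact congrArg (fun w => s(0, w)) (Fin.ext (by simp only [fanVertex]; omega))

theorem exists_reachable_isFan [Fintype R] (hp : IsConvexPolygon p) (hR : Fintype.card R = n)
    (t : ColoredTriangulation p R) :
    ∃ (t' : ColoredTriangulation p R) (σ : Fin n ≃ R),
      (colorfulExchangeGraph p R).Reachable t t' ∧ t'.IsFan σ := by
  -- Each flip strictly enlarges this subset of a finite set, so the induction runs upward.
  generalize hS : {v | t.IsEdge s(0, v)} = S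
  induction S using WellFoundedGT.induction generalizing t with
  | ind S ih =>
    by_cases hex : ∃ v, v ≠ 0 ∧ ¬ t.IsEdge s(0, v)
    · obtain ⟨t', hadj, hlt⟩ := exists_adj_ssubset hp t hex
      obtain ⟨t'', σ, hr, hf⟩ := ih _ (hS ▸ hlt) t' rfl
      exact ⟨t'', σ, hadj.reachable.trans hr, hf⟩
    · push Not at hex
      have hmem : ∀ i : Fin n, ∃ c, (s(0, fanVertex i), c) ∈ t.diagonals := by
        intro i
        have h0 : (0 : Fin (n + 3)) ≠ fanVertex i := by
          rw [Ne, Fin.ext_iff]; simp [fanVertex]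
        rcases hex (fanVertex i) h0.symm with hs | ⟨⟨e, c⟩, he, rfl⟩
        · exfalso
          have hi := i.2
          rcases (isSide_iff h0).1 hs with h1 | h1
          · refine h1 ⟨1, by omega⟩ ?_
            rw [Cyc.iff_val]; simp [fanVertex]
          · refine h1 (Fin.last _) ?_
            rw [Cyc.iff_val]; simp [fanVertex]
        · exact ⟨c, he⟩
      choose col hcol using hmem
      have hinj : Function.Injective col := by
        intro i j hij
        have h1 := hcol i
        rw [hij] at h1
        exact fanVertex_injective (Sym2.congr_right.1 (color_inj h1 (hcol j)))
      refine ⟨t, Equiv.ofBijective col ?_, SimpleGraph.Reachable.refl _, hcol⟩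
      exact (Fintype.bijective_iff_injective_and_card col).2 ⟨hinj, by simp [hR]⟩

theorem isSide_of_val {a b : Fin (n + 3)} (h : b.val = a.val + 1) : IsSide s(a, b) := by
  refine ⟨a, ?_⟩
  have := b.2
  rw [show b = a + 1 from Fin.ext ?_]
  rw [Fin.val_add_one, if_neg, h]
  rw [Fin.ext_iff, Fin.val_last]
  omega

/-- In a fan, the colors of two consecutive diagonals can be exchanged. -/
theorem IsFan.exists_swap (hp : IsConvexPolygon p) {t : ColoredTriangulation p R}
    {σ : Fin n ≃ R} (h : t.IsFan σ) {i j : Fin n} (hij : (j : ℕ) = i + 1) :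
    ∃ t' : ColoredTriangulation p R, (colorfulExchangeGraph p R).Reachable t t' ∧
      t'.IsFan ((Equiv.swap i j).trans σ) := by
  have hj := j.2
  have hne : ∀ k : Fin (n + 3), 0 < k.val → k ≠ 0 := by
    rintro k hk rfl
    exact hk.ne rfl
  -- The pentagon has vertices `0` and `i + 1` up to `i + 4`; its edges at `0` may be diagonals of
  -- the fan or sides of the polygon.
  let v₁ : Fin (n + 3) := ⟨i + 1, by omega⟩
  let v₄ : Fin (n + 3) := ⟨i + 4, by omega⟩
  obtain ⟨t', hr, hx, hy, hkeep⟩ := exists_reachable_pentagon hp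
    (v₀ := 0) (v₁ := v₁) (v₂ := fanVertex i) (v₃ := fanVertex j) (v₄ := v₄)
    (by simp [Fin.ext_iff, v₁, v₄, fanVertex, hij]) (h i) (h j)
    (h.isEdge (hne _ (Nat.succ_pos _))) (Or.inl (isSide_of_val rfl))
    (Or.inl (isSide_of_val (by simp [fanVertex, hij])))
    (Or.inl (isSide_of_val (by simp [fanVertex, v₄, hij]))) (h.isEdge (hne _ (Nat.succ_pos _)))
  refine ⟨t', hr, fun k => ?_⟩
  simp only [Equiv.trans_apply]
  by_cases hki : k = i
  · rw [hki, Equiv.swap_apply_left]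
    exact hy
  by_cases hkj : k = j
  · rw [hkj, Equiv.swap_apply_right]
    exact hx
  · rw [Equiv.swap_apply_of_ne_of_ne hki hkj]
    exact hkeep _ _ (fun he => hki (σ.injective he)) (fun he => hkj (σ.injective he)) (h k)

/-- Adjacent transpositions generate all permutations. -/
theorem IsFan.exists_perm (hp : IsConvexPolygon p) (π : Equiv.Perm (Fin n)) :
    ∀ {t : ColoredTriangulation p R} {σ : Fin n ≃ R}, t.IsFan σ →
      ∃ t' : ColoredTriangulation p R, (colorfulExchangeGraph p R).Reachable t t' ∧
        t'.IsFan (π.trans σ) := by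
  cases n with
  | zero => exact fun {t} σ _ => ⟨t, SimpleGraph.Reachable.refl _, fun i => i.elim0⟩
  | succ m =>
    have hπ : π ∈ Submonoid.closure
        (Set.range fun i : Fin m => Equiv.swap i.castSucc i.succ) := by
      rw [Equiv.Perm.mclosure_swap_castSucc_succ]
      trivial
    induction hπ using Submonoid.closure_induction with
    | mem x hx =>
      obtain ⟨i, rfl⟩ := hx
      intro t σ h
      exact h.exists_swap hp (by simp)
    | one => exact fun {t} σ h => ⟨t, SimpleGraph.Reachable.refl _, h⟩
    | mul x y _ _ ihx ihy =>
      intro t σ h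
      obtain ⟨t', hr, h'⟩ := ihx h
      obtain ⟨t'', hr', h''⟩ := ihy h'
      exact ⟨t'', hr.trans hr', h''⟩

theorem exchangeGraph_preconnected [Fintype R] (hp : IsConvexPolygon p)
    (hR : Fintype.card R = n) : (colorfulExchangeGraph p R).Preconnected := by
  intro t t'
  obtain ⟨s, σ, hr, hs⟩ := t.exists_reachable_isFan hp hR
  obtain ⟨s', τ, hr', hs'⟩ := t'.exists_reachable_isFan hp hR
  -- This permutation turns the coloring `σ` into `τ`, and a fan is determined by its coloring.
  obtain ⟨u, hu, hu'⟩ := hs.exists_perm hp (τ.trans σ.symm)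
  have : u = s' := by
    refine hu'.eq hp hR ?_
    rwa [Equiv.trans_assoc, Equiv.symm_trans_self, Equiv.trans_refl]
  exact hr.trans (hu.trans (this ▸ hr'.symm))

theorem nonempty [Fintype R] (hp : IsConvexPolygon p) (hR : Fintype.card R = n) :
    Nonempty (ColoredTriangulation p R) := by
  obtain ⟨D, hD⟩ := exists_maximal_combNoncrossing n
  have hcard : Nat.card D = Nat.card R := by
    rw [Nat.card_coe_set_eq, ncard_of_maximal hD, Nat.card_eq_fintype_card, hR]
  obtain ⟨e⟩ := Finite.card_eq.1 hcard
  refine ⟨⟨Set.range fun d : D => ((d : Sym2 (Fin (n + 3))), e d), ?_, ?_, ?_⟩⟩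
  · rw [← Set.range_comp]
    change IsTriangulation p (Set.range (Subtype.val : D → _))
    rw [Subtype.range_coe]
    exact (isTriangulation_iff hp D).2 hD
  · rintro _ ⟨d, rfl⟩ _ ⟨d', rfl⟩ h
    rw [Subtype.ext h]
  · rintro _ ⟨d, rfl⟩ _ ⟨d', rfl⟩ h
    rw [e.injective h]

/-! ### Color classes -/

/-- Flips of one color are unique and reversible, so a second flip of that color returns to the
start. -/
theorem colorClass_singleton (hp : IsConvexPolygon p) {c : R} {t s : ColoredTriangulation p R}
    (hs : IsFlip c t s) : colorClass {c} t = {t, s} := by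
  refine Set.Subset.antisymm (fun u hu => ?_) ?_
  · change (flipGraph p _).Reachable t u at hu
    rw [SimpleGraph.reachable_iff_reflTransGen] at hu
    induction hu with
    | refl => exact Or.inl rfl
    | tail _ hstep ih =>
      obtain ⟨c', hc', hf⟩ := hstep
      obtain rfl : c' = c := by simpa using hc'
      rcases ih with rfl | rfl
      · exact Or.inr (hf.unique hp hs)
      · exact Or.inl (hf.unique hp hs.symm)
  · rintro _ (rfl | rfl)
    · exact SimpleGraph.Reachable.refl _
    · exact SimpleGraph.Adj.reachable ⟨c, by simp, hs⟩

theorem isColorClassSystem [Fintype R] (hp : IsConvexPolygon p) (hR : Fintype.card R = n) :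
    IsColorClassSystem (fun (C : Finset R) (t : ColoredTriangulation p R) => colorClass C t) := by
  have hadj : ∀ {C : Finset R} {c : R} {t s : ColoredTriangulation p R}, c ∈ C → IsFlip c t s →
      s ∈ colorClass C t := fun hc h => SimpleGraph.Adj.reachable ⟨_, hc, h⟩
  refine ⟨fun C t => SimpleGraph.Reachable.refl _, ?_, ?_, ?_, ?_, ?_, ?_⟩
  · intro C s t hs
    exact Set.ext fun u => ⟨fun hu => SimpleGraph.Reachable.trans hs hu,
      fun hu => SimpleGraph.Reachable.trans (SimpleGraph.Reachable.symm hs) hu⟩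
  · intro C D t
    refine ⟨fun hsub c hc => ?_, fun hsub u hu => ?_⟩
    -- If `c` is not in `D`, the flip of color `c` would reach a triangulation whose diagonal
    -- colored `c` has moved, which no path with colors in `D` can do.
    · by_contra hD
      obtain ⟨s, hs⟩ := exists_isFlip hp hR c t
      have hiff := mem_iff_of_reachable (C := (D : Set R)) hD (hsub (hadj hc hs))
      obtain ⟨i, j, k, l, hd, -, -, -, hs'⟩ := id hs
      refine hs.ne (ColoredTriangulation.ext ?_)
      have hkl : (s(k, l), c) ∈ s.diagonals := hs' ▸ Set.mem_insert _ _
      rw [hs', ← color_inj hd ((hiff _).1 hkl), Set.insert_sdiff_singleton,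
        Set.insert_eq_of_mem hd]
    · exact SimpleGraph.Reachable.mono (show flipGraph p (C : Set R) ≤ flipGraph p (D : Set R) from
        fun a b ⟨c, hc, h⟩ => ⟨c, hsub hc, h⟩) hu
  · intro t
    refine Set.eq_singleton_iff_unique_mem.2 ⟨SimpleGraph.Reachable.refl _, fun u hu => ?_⟩
    change (flipGraph p _).Reachable t u at hu
    rw [SimpleGraph.reachable_iff_reflTransGen] at hu
    induction hu with
    | refl => rfl
    | tail _ hstep _ =>
      obtain ⟨c, hc, -⟩ := hstep
      simp at hc
  · intro t
    refine Set.eq_univ_of_forall fun u => ?_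
    change (flipGraph p _).Reachable t u
    rw [Finset.coe_univ]
    exact exchangeGraph_preconnected hp hR t u
  · intro c t
    obtain ⟨s, hs⟩ := exists_isFlip hp hR c t
    exact ⟨s, hs.ne.symm, colorClass_singleton hp hs⟩
  · intro C s t hs
    change (flipGraph p _).Reachable t s at hs
    rw [SimpleGraph.reachable_iff_reflTransGen] at hs
    refine Relation.ReflTransGen.mono ?_ t s hs
    rintro a b ⟨c, hc, h⟩
    exact ⟨c, hc, hadj (Finset.mem_singleton_self c) h⟩

theorem exchangeGraph_adj_iff [Fintype R] (hp : IsConvexPolygon p) (hR : Fintype.card R = n)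
    (s t : ColoredTriangulation p R) :
    (colorfulExchangeGraph p R).Adj t s ↔ s ≠ t ∧ ∃ c, colorClass {c} t = {t, s} := by
  constructor
  · rintro ⟨c, -, hs⟩
    exact ⟨hs.ne.symm, c, colorClass_singleton hp hs⟩
  · rintro ⟨hst, c, hc⟩
    obtain ⟨u, hu⟩ := exists_isFlip hp hR c t
    have hs : s ∈ colorClass {c} t := by
      rw [hc]
      exact Or.inr rfl
    rw [colorClass_singleton hp hu] at hs
    rcases hs with rfl | rfl
    · exact absurd rfl hst
    · exact ⟨c, Set.mem_univ c, hu⟩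

end ColoredTriangulation

theorem theorem3p3 (n : ℕ) (p : Fin (n + 3) → EuclideanSpace ℝ (Fin 2)) (hp : IsConvexPolygon p)
    (R : Type*) [Fintype R] (hR : Fintype.card R = n) :
    ∃ rank : ColorfulAssociahedron p R → ℤ,
      (∀ (C : Finset R) (t : ColoredTriangulation p R),
        rank (ColorfulAssociahedron.face C t) = (C.card : ℤ)) ∧
      IsSimpleAbstractPolytope n rank ∧
      ∃ φ : OneSkeletonIso (colorfulExchangeGraph p R) rank,
        (∀ t : ColoredTriangulation p R,
          ((φ.vertexEquiv t : ColorfulAssociahedron p R) : Set (ColoredTriangulation p R)) = {t}) ∧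
        (∀ e : (colorfulExchangeGraph p R).edgeSet,
          ((φ.edgeEquiv e : ColorfulAssociahedron p R) : Set (ColoredTriangulation p R)) =
            {t | t ∈ (e : Sym2 (ColoredTriangulation p R))}) := by
  have h := ColoredTriangulation.isColorClassSystem hp hR
  have : Nonempty (ColoredTriangulation p R) := ColoredTriangulation.nonempty hp hR
  exact ⟨ClassPoset.rank _, h.rank_face, h.isSimpleAbstractPolytope hR,
    h.exists_oneSkeletonIso _ (ColoredTriangulation.exchangeGraph_adj_iff hp hR)⟩
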